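/- **Definitions.** A relation algebra is an algebra $\mathfrak A=(A,+,-,;,{}^\smile,1')$ such that $(A,+,-)$ is a Boolean algebra and, for all $r,s,t\in A$: $r;(s;t)=(r;s);t$, $r;1'=r$, $r^{\smile\smile}=r$, $(r;s)^\smile=s^\smile;r^\smile$, $(r+s);t=r;t+s;t$, $(r+s)^\smile=r^\smile+s^\smile$, and $r^\smile;-(r;s)+(-s)=-s$. An element $f$ is *functional* if $f^\smile;f\le 1'$. An atom $x\le 1'$ is *measurable* if $x;1;x$ is the sum (supremum) of the non-zero functional elements below it; these elements then form a group $G_x$ under $;$ and ${}^\smile$ with identity element $x$. The algebra $\mathfrak A$ is *measurable* if $1'$ is the sum of the measurable atoms. A *completion* of $\mathfrak A$ is a complete relation algebra $\mathfrak B$ that has $\mathfrak A$ as a subalgebra and in which every element is the sum of the elements of $\mathfrak A$ below it. It is unique up to isomorphism over $\mathfrak A$. The algebra $\mathfrak A$ is *essentially isomorphic* to $\mathfrak C$ if its completion is isomorphic to $\mathfrak C$. A *set relation algebra* on a set $U$ is a collection of binary relations on $U$ that has a largest element, contains the identity relation on $U$, and is closed under union, complement in the largest element, relational composition and relational inverse,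 with these as its operations. The algebra $\mathfrak A$ is *completely representable* if there is an isomorphism of $\mathfrak A$ onto some set relation algebra that takes every existing supremum in $\mathfrak A$ to the union of the images. *Cyclic group relation algebras.* Let $E$ be an equivalence relation on a set $I$, let $n_x$ $(x\in I)$ be positive integers, and let $m_{xy}$ $((x,y)\in E)$ be positive integers such that, for all $(x,y),(y,z)\in E$, 1. $m_{xy}$ divides $n_x$ and $n_y$; 2. $m_{xx}=n_x$; 3. $m_{yx}=m_{xy}$; 4. $\gcd(m_{xy},m_{yz})=\gcd(m_{xy},m_{xz})=\gcd(m_{xz},m_{yz})$. Let $G_x$ $(x\in I)$ be pairwise disjoint copies of $\mathbb Z/n_x\mathbb Z$, let $H_{xy}\le G_x$ and $K_{xy}\le G_y$ be the subgroups of the multiples of $m_{xy}$, and let $\varphi_{xy}\colon G_x/H_{xy}\to G_y/K_{xy}$ be the isomorphism $H_{xy}+\ell\mapsto K_{xy}+\ell$. For $(x,y)\in E$ and a coset $\alpha$ of $H_{xy}$ put $$R_{xy,\alpha}=\bigcup_{\gamma\in G_x/H_{xy}}\gamma\times\varphi_{xy}(\gamma+\alpha).$$ The set of all unions of relations $R_{xy,\alpha}$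 is the universe of a set relation algebra on $\bigcup_{x\in I}G_x$, called the *cyclic group relation algebra* determined by $(E,n,m)$. **Theorem (Representation Theorem).** Let $\mathfrak A$ be a measurable relation algebra such that, for each measurable atom $x$, the group $G_x$ is finite and cyclic. Then $\mathfrak A$ is essentially isomorphic to a cyclic group relation algebra determined by some system $(E,n,m)$ as above. Moreover, $\mathfrak A$ is completely representable. -/

import Mathlib

universe u v w

namespace RelAlg

/-- A relation algebra in the sense of Tarski: a Boolean algebra with relative multiplication
`comp`, converse `conv` and an identity element `ident`, subject to Tarski's axioms. -/
class RelationAlgebra (A : Type u) extends BooleanAlgebra A where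
  comp : A → A → A
  conv : A → A
  ident : A
  comp_assoc : ∀ r s t : A, comp r (comp s t) = comp (comp r s) t
  comp_ident : ∀ r : A, comp r ident = r
  conv_conv : ∀ r : A, conv (conv r) = r
  conv_comp : ∀ r s : A, conv (comp r s) = comp (conv s) (conv r)
  sup_comp : ∀ r s t : A, comp (r ⊔ s) t = comp r t ⊔ comp s t
  conv_sup : ∀ r s : A, conv (r ⊔ s) = conv r ⊔ conv s
  tarski : ∀ r s : A, comp (conv r) (comp r s)ᶜ ⊔ sᶜ = sᶜ

namespace RelationAlgebra

variable {A : Type u} [RelationAlgebra A]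

/-! ### Elementary arithmetic -/

theorem le_tarski (r s : A) : comp (conv r) (comp r s)ᶜ ≤ sᶜ := by
  have h := tarski r s
  exact sup_eq_right.mp h

theorem conv_mono {a b : A} (h : a ≤ b) : conv a ≤ conv b := by
  have h1 := conv_sup a b
  rw [sup_eq_right.mpr h] at h1
  rw [h1]
  exact le_sup_left

theorem comp_mono_left {a b : A} (c : A) (h : a ≤ b) : comp a c ≤ comp b c := by
  have h1 := sup_comp a b c
  rw [sup_eq_right.mpr h] at h1
  rw [h1]
  exact le_sup_left

theorem comp_sup (r s t : A) : comp r (s ⊔ t) = comp r s ⊔ comp r t := by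
  rw [← conv_conv (comp r (s ⊔ t)), conv_comp, conv_sup, sup_comp, conv_sup, conv_comp,
    conv_comp, conv_conv, conv_conv, conv_conv]

theorem comp_mono_right {a b : A} (c : A) (h : a ≤ b) : comp c a ≤ comp c b := by
  have h1 := comp_sup c a b
  rw [sup_eq_right.mpr h] at h1
  rw [h1]
  exact le_sup_left

theorem comp_mono {a b c d : A} (h : a ≤ b) (h' : c ≤ d) : comp a c ≤ comp b d :=
  (comp_mono_left c h).trans (comp_mono_right b h')

theorem conv_ident : conv (ident : A) = ident := by
  have h := conv_comp (conv (ident : A)) ident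
  rw [comp_ident, conv_conv, comp_ident] at h
  exact h.symm

theorem ident_comp (r : A) : comp ident r = r := by
  rw [← conv_conv (comp ident r), conv_comp, conv_ident, comp_ident, conv_conv]

theorem cycle {a b c : A} (h : comp a b ≤ cᶜ) : comp (conv a) c ≤ bᶜ :=
  (comp_mono_right _ (le_compl_comm.mp h)).trans (le_tarski a b)

/-- The modular law. -/
theorem modular (a b c : A) : comp a b ⊓ c ≤ comp a (b ⊓ comp (conv a) c) := by
  have h2 : comp a (b ⊓ (comp (conv a) c)ᶜ) ≤ cᶜ := by
    have h := cycle (a := conv a) (b := c) (c := (comp (conv a) c)ᶜ) (by rw [compl_compl])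
    rw [conv_conv] at h
    exact (comp_mono_right _ inf_le_right).trans h
  have h3 : comp a b = comp a (b ⊓ comp (conv a) c) ⊔ comp a (b ⊓ (comp (conv a) c)ᶜ) := by
    rw [← comp_sup, ← inf_sup_left, sup_compl_eq_top, inf_top_eq]
  rw [h3, inf_sup_right]
  refine sup_le inf_le_left ?_
  exact (inf_le_inf_right c h2).trans (by rw [compl_inf_eq_bot]; exact bot_le)

theorem le_comp_conv_comp (a : A) : a ≤ comp a (comp (conv a) a) := by
  have h := modular a ident a
  rw [comp_ident, inf_idem] at h
  exact h.trans (comp_mono_right _ inf_le_right)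

theorem conv_bot : conv (⊥ : A) = ⊥ := by
  have h := conv_mono (bot_le : (⊥ : A) ≤ conv ⊥)
  rw [conv_conv] at h
  exact le_bot_iff.mp h

theorem comp_bot (a : A) : comp a ⊥ = ⊥ := by
  have h := cycle (a := conv a) (b := ⊤) (c := ⊥) (by rw [compl_bot]; exact le_top)
  rw [conv_conv, compl_top] at h
  exact le_bot_iff.mp h

theorem conv_eq_self {x : A} (hx : x ≤ ident) : conv x = x := by
  have key : ∀ y : A, y ≤ ident → y ≤ conv y := by
    intro y hy
    calc y ≤ comp y (comp (conv y) y) := le_comp_conv_comp y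
      _ ≤ comp ident (comp (conv y) ident) := comp_mono hy (comp_mono_right _ hy)
      _ = conv y := by rw [ident_comp, comp_ident]
  apply le_antisymm _ (key x hx)
  have h := key (conv x) (by rw [← conv_ident]; exact conv_mono hx)
  rwa [conv_conv] at h

theorem comp_self {x : A} (hx : x ≤ ident) : comp x x = x := by
  apply le_antisymm
  · exact (comp_mono_right _ hx).trans (comp_ident x).le
  · calc x ≤ comp x (comp (conv x) x) := le_comp_conv_comp x
      _ ≤ comp x (comp ident x) := comp_mono_right _
          (comp_mono_left _ (by rw [conv_eq_self hx]; exact hx))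
      _ = comp x x := by rw [ident_comp]

/-! ### Measurable relation algebras -/

/-- The square `x;1;x`. -/
def square (x : A) : A := comp (comp x ⊤) x

/-- `f` is functional if `f˘;f ≤ 1'`. -/
def IsFunctional (f : A) : Prop := comp (conv f) f ≤ ident

/-- The set of nonzero functional elements below `x;1;x`. -/
def functionsBelow (x : A) : Set A := {f | f ≠ ⊥ ∧ f ≤ square x ∧ IsFunctional f}

/-- A subidentity atom is measurable if its square is a sum of functional elements. -/
structure IsMeasurableAtom (x : A) : Prop where
  isAtom : IsAtom x
  le_ident : x ≤ ident
  isLUB : IsLUB (functionsBelow x) (square x)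

variable (A) in
/-- A relation algebra is measurable if its identity element is the sum of measurable atoms. -/
def IsMeasurable : Prop := IsLUB {x : A | IsMeasurableAtom x} ident

theorem comp_of_le_square {x f : A} (hx : x ≤ ident) (hf : f ≤ square x) : comp x f = f := by
  apply le_antisymm
  · exact (comp_mono_left _ hx).trans (ident_comp f).le
  · have h := modular x (comp ⊤ x) f
    rw [square] at hf
    rw [comp_assoc, inf_eq_right.mpr hf, conv_eq_self hx] at h
    refine h.trans ((comp_mono_right _ inf_le_right).trans ?_)
    rw [comp_assoc, comp_self hx]

theorem conv_square {x : A} (hx : x ≤ ident) : conv (square x) = square x := by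
  have htop : conv (⊤ : A) = ⊤ := by
    apply le_antisymm le_top
    have h := conv_mono (le_top : conv (⊤ : A) ≤ ⊤)
    rwa [conv_conv] at h
  rw [square, conv_comp, conv_comp, conv_eq_self hx, htop, comp_assoc]

theorem conv_le_square {x f : A} (hx : x ≤ ident) (hf : f ≤ square x) : conv f ≤ square x := by
  have h := conv_mono hf
  rwa [conv_square hx] at h

theorem comp_of_le_square' {x f : A} (hx : x ≤ ident) (hf : f ≤ square x) : comp f x = f := by
  have h := congrArg conv (comp_of_le_square hx (conv_le_square hx hf))
  rwa [conv_comp, conv_conv, conv_eq_self hx] at h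

theorem comp_le_square {x f g : A} (hf : f ≤ square x) (hg : g ≤ square x) :
    comp f g ≤ square x := by
  refine (comp_mono hf hg).trans ?_
  have h : comp (comp (comp x ⊤) x) (comp (comp x ⊤) x)
      = comp (comp x (comp ⊤ (comp (comp x x) ⊤))) x := by
    simp only [comp_assoc]
  rw [square, h]
  exact comp_mono_left _ (comp_mono_right _ le_top)

theorem conv_comp_self_eq {x f : A} (hx : IsAtom x) (hx1 : x ≤ ident)
    (hf : f ∈ functionsBelow x) : comp (conv f) f = x := by
  obtain ⟨h0, hs, hfun⟩ := hf
  have hle : comp (conv f) f ≤ x := by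
    have h1 : comp (comp (comp x (conv f)) f) x = comp (conv f) f := by
      rw [comp_of_le_square hx1 (conv_le_square hx1 hs), ← comp_assoc,
        comp_of_le_square' hx1 hs]
    rw [← h1]
    calc comp (comp (comp x (conv f)) f) x = comp (comp x (comp (conv f) f)) x := by
          rw [comp_assoc]
      _ ≤ comp (comp x ident) x := comp_mono_left _ (comp_mono_right _ hfun)
      _ = x := by rw [comp_ident, comp_self hx1]
  rcases hx.le_iff.mp hle with h | h
  · exfalso
    apply h0
    have h2 := le_comp_conv_comp f
    rw [h, comp_bot] at h2
    exact le_bot_iff.mp h2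
  · exact h

theorem self_mem_functionsBelow {x : A} (hx : IsAtom x) (hx1 : x ≤ ident) :
    x ∈ functionsBelow x := by
  refine ⟨hx.1, ?_, ?_⟩
  · calc x = comp (comp x x) x := by rw [comp_self hx1, comp_self hx1]
      _ ≤ square x := comp_mono_left _ (comp_mono_right _ le_top)
  · rw [IsFunctional, conv_eq_self hx1, comp_self hx1]
    exact hx1

theorem comp_mem_functionsBelow {x f g : A} (hx : IsAtom x) (hx1 : x ≤ ident)
    (hf : f ∈ functionsBelow x) (hg : g ∈ functionsBelow x) : comp f g ∈ functionsBelow x := by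
  have e : comp (conv (comp f g)) (comp f g) = x := by
    calc comp (conv (comp f g)) (comp f g) = comp (conv g) (comp (comp (conv f) f) g) := by
          rw [conv_comp]; simp only [comp_assoc]
      _ = x := by
          rw [conv_comp_self_eq hx hx1 hf, comp_of_le_square hx1 hg.2.1,
            conv_comp_self_eq hx hx1 hg]
  refine ⟨?_, comp_le_square hf.2.1 hg.2.1, ?_⟩
  · intro h
    rw [h, comp_bot] at e
    exact hx.1 e.symm
  · rw [IsFunctional, e]
    exact hx1

theorem conv_mem_functionsBelow {x f : A} (hx : IsMeasurableAtom x)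
    (hf : f ∈ functionsBelow x) : conv f ∈ functionsBelow x := by
  have hx1 := hx.le_ident
  have hc0 : conv f ≠ ⊥ := by
    intro h
    apply hf.1
    rw [← conv_conv f, h, conv_bot]
  have hcs := conv_le_square hx1 hf.2.1
  obtain ⟨g, hg, hgf⟩ : ∃ g ∈ functionsBelow x, conv f ⊓ g ≠ ⊥ := by
    by_contra hcon
    push Not at hcon
    have h1 : square x ≤ (conv f)ᶜ := by
      refine hx.isLUB.2 ?_
      intro g hg
      exact le_compl_iff_disjoint_left.mpr (disjoint_iff.mpr (hcon g hg))
    exact hc0 (le_bot_iff.mp (by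
      have := le_inf le_rfl (hcs.trans h1)
      rwa [inf_compl_eq_bot] at this))
  set h := conv f ⊓ g with hh
  have hle : h ≤ conv f := inf_le_left
  have hhm : h ∈ functionsBelow x := by
    refine ⟨hgf, hle.trans hcs, ?_⟩
    exact (comp_mono (conv_mono inf_le_right) inf_le_right).trans hg.2.2
  have h1 : f ≤ conv h := by
    calc f = comp x f := (comp_of_le_square hx1 hf.2.1).symm
      _ = comp (comp (conv h) h) f := by rw [conv_comp_self_eq hx.isAtom hx1 hhm]
      _ = comp (conv h) (comp h f) := by rw [comp_assoc]
      _ ≤ comp (conv h) (comp (conv f) f) := comp_mono_right _ (comp_mono_left _ hle)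
      _ = comp (conv h) x := by rw [conv_comp_self_eq hx.isAtom hx1 hf]
      _ = conv h := comp_of_le_square' hx1 (conv_le_square hx1 hhm.2.1)
  have h2 : conv f ≤ h := by
    have := conv_mono h1
    rwa [conv_conv] at this
  have h3 : conv f = h := le_antisymm h2 hle
  rw [h3]
  exact hhm

/-- The set `G_x` of nonzero functional elements below `x;1;x`, for a measurable atom `x`. -/
def AtomGroup (x : {x : A // IsMeasurableAtom x}) : Type u := {f : A // f ∈ functionsBelow x.1}

/-- `G_x` is a group under relative multiplication and converse, with identity element `x`. -/
instance (x : {x : A // IsMeasurableAtom x}) : Group (AtomGroup x) where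
  mul f g := ⟨comp f.1 g.1, comp_mem_functionsBelow x.2.isAtom x.2.le_ident f.2 g.2⟩
  one := ⟨x.1, self_mem_functionsBelow x.2.isAtom x.2.le_ident⟩
  inv f := ⟨conv f.1, conv_mem_functionsBelow x.2 f.2⟩
  mul_assoc f g h := Subtype.ext (comp_assoc f.1 g.1 h.1).symm
  one_mul f := Subtype.ext (comp_of_le_square x.2.le_ident f.2.2.1)
  mul_one f := Subtype.ext (comp_of_le_square' x.2.le_ident f.2.2.1)
  inv_mul_cancel f := Subtype.ext (conv_comp_self_eq x.2.isAtom x.2.le_ident f.2)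

/-! ### Embeddings and completions -/

/-- A relation algebra embedding. -/
structure IsEmbedding {B : Type v} [RelationAlgebra B] (e : A → B) : Prop where
  injective : Function.Injective e
  map_sup : ∀ a b, e (a ⊔ b) = e a ⊔ e b
  map_compl : ∀ a, e aᶜ = (e a)ᶜ
  map_comp : ∀ a b, e (comp a b) = comp (e a) (e b)
  map_conv : ∀ a, e (conv a) = conv (e a)
  map_ident : e ident = ident

/-- A relation algebra isomorphism. -/
structure IsIsomorphism {B : Type v} [RelationAlgebra B] (e : A → B) : Prop
    extends IsEmbedding e where
  surjective : Function.Surjective e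

/-- `e : A → B` exhibits `B` as the completion (minimal complete extension) of `A`: `B` is
complete, `e` is an embedding, and every element of `B` is the sum of the elements of (the image
of) `A` below it. -/
structure IsCompletion {B : Type v} [RelationAlgebra B] (e : A → B) : Prop
    extends IsEmbedding e where
  complete : ∀ S : Set B, ∃ b, IsLUB S b
  dense : ∀ b : B, IsLUB {c | c ∈ Set.range e ∧ c ≤ b} b

/-- `A` is essentially isomorphic to `C` if the completion of `A` is isomorphic to `C`. -/
def EssentiallyIsomorphic (A : Type u) (C : Type u) [RelationAlgebra A] [RelationAlgebra C] :
    Prop :=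
  ∃ (B : Type u) (_ : RelationAlgebra B),
    (∃ e : A → B, IsCompletion e) ∧ ∃ i : B → C, IsIsomorphism i

end RelationAlgebra

/-! ### Set relation algebras -/

/-- A set relation algebra on a base set `U`: a collection of binary relations on `U` with a
largest element (the unit), closed under union, complement in the unit, relational composition
and relational inverse, and containing the identity relation on `U`. -/
structure SetRelationAlgebra (U : Type u) where
  carrier : Set (SetRel U U)
  unit : SetRel U U
  unit_mem : unit ∈ carrier
  subset_unit : ∀ R ∈ carrier, R ⊆ unit
  union_mem : ∀ R ∈ carrier, ∀ S ∈ carrier, R ∪ S ∈ carrier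
  compl_mem : ∀ R ∈ carrier, unit \ R ∈ carrier
  comp_mem : ∀ R ∈ carrier, ∀ S ∈ carrier, R.comp S ∈ carrier
  inv_mem : ∀ R ∈ carrier, R.inv ∈ carrier
  id_mem : (SetRel.id : SetRel U U) ∈ carrier

namespace SetRelationAlgebra

variable {U : Type u} (S : SetRelationAlgebra U)

/-- The elements of a set relation algebra. -/
def Elem : Type u := {R : SetRel U U // R ∈ S.carrier}

theorem empty_mem : (∅ : SetRel U U) ∈ S.carrier := by
  have h := S.compl_mem _ S.unit_mem
  rwa [Set.sdiff_self] at h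

theorem inter_mem {R T : SetRel U U} (hR : R ∈ S.carrier) (hT : T ∈ S.carrier) :
    R ∩ T ∈ S.carrier := by
  have h := S.compl_mem _ (S.union_mem _ (S.compl_mem _ hR) _ (S.compl_mem _ hT))
  have e : S.unit \ (S.unit \ R ∪ S.unit \ T) = R ∩ T := by
    ext p
    have : p ∈ R → p ∈ S.unit := fun h => S.subset_unit R hR h
    simp only [Set.mem_sdiff, Set.mem_union, Set.mem_inter_iff]
    tauto
  rwa [e] at h

theorem unit_inv {u v : U} (h : (u, v) ∈ S.unit) : (v, u) ∈ S.unit :=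
  S.subset_unit _ (S.inv_mem _ S.unit_mem) h

theorem unit_comp {u v w : U} (h : (u, v) ∈ S.unit) (h' : (v, w) ∈ S.unit) : (u, w) ∈ S.unit :=
  S.subset_unit _ (S.comp_mem _ S.unit_mem _ S.unit_mem) ⟨v, h, h'⟩

/-- The relation algebra operations of a set relation algebra are the set-theoretic ones. -/
instance : RelationAlgebra S.Elem where
  le R T := R.1 ⊆ T.1
  lt R T := R.1 ⊆ T.1 ∧ ¬ T.1 ⊆ R.1
  le_refl R := subset_refl R.1
  le_trans R T V h h' := subset_trans h h'
  lt_iff_le_not_ge R T := Iff.rfl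
  le_antisymm R T h h' := Subtype.ext (Set.Subset.antisymm h h')
  sup R T := ⟨R.1 ∪ T.1, S.union_mem _ R.2 _ T.2⟩
  le_sup_left R T := Set.subset_union_left
  le_sup_right R T := Set.subset_union_right
  sup_le R T V h h' := Set.union_subset h h'
  inf R T := ⟨R.1 ∩ T.1, S.inter_mem R.2 T.2⟩
  inf_le_left R T := Set.inter_subset_left
  inf_le_right R T := Set.inter_subset_right
  le_inf R T V h h' := Set.subset_inter h h'
  le_sup_inf R T V := (Set.union_inter_distrib_left R.1 T.1 V.1).symm.subset
  compl R := ⟨S.unit \ R.1, S.compl_mem _ R.2⟩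
  top := ⟨S.unit, S.unit_mem⟩
  bot := ⟨∅, S.empty_mem⟩
  inf_compl_le_bot R := fun _ h => h.2.2 h.1
  top_le_sup_compl R := fun p hp => (Classical.em (p ∈ R.1)).imp id fun h => ⟨hp, h⟩
  le_top R := S.subset_unit _ R.2
  bot_le R := Set.empty_subset _
  comp R T := ⟨R.1.comp T.1, S.comp_mem _ R.2 _ T.2⟩
  conv R := ⟨R.1.inv, S.inv_mem _ R.2⟩
  ident := ⟨SetRel.id, S.id_mem⟩
  comp_assoc R T V := Subtype.ext (SetRel.comp_assoc R.1 T.1 V.1).symm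
  comp_ident R := Subtype.ext (SetRel.comp_id R.1)
  conv_conv R := rfl
  conv_comp R T := Subtype.ext (SetRel.inv_comp R.1 T.1)
  sup_comp R T V := Subtype.ext (by
    ext p
    constructor
    · rintro ⟨b, h | h, h'⟩
      exacts [Or.inl ⟨b, h, h'⟩, Or.inr ⟨b, h, h'⟩]
    · rintro (⟨b, h, h'⟩ | ⟨b, h, h'⟩)
      exacts [⟨b, Or.inl h, h'⟩, ⟨b, Or.inr h, h'⟩])
  conv_sup R T := rfl
  tarski R T := Subtype.ext (Set.union_eq_self_of_subset_left (by
    rintro ⟨u, w⟩ ⟨v, h, h', h''⟩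
    exact ⟨S.unit_comp (S.unit_inv (S.subset_unit _ R.2 h)) h', fun h3 => h'' ⟨u, h, h3⟩⟩))

end SetRelationAlgebra

/-- A relation algebra is completely representable if it is isomorphic to a set relation algebra
via an isomorphism that takes every existing sum to the union. -/
def CompletelyRepresentable (A : Type u) [RelationAlgebra A] : Prop :=
  ∃ (U : Type u) (S : SetRelationAlgebra U) (e : A → S.Elem), RelationAlgebra.IsIsomorphism e ∧
    ∀ (X : Set A) (a : A), IsLUB X a → (e a).1 = ⋃ x ∈ X, (e x).1

/-! ### Cyclic group relation algebras -/

/-- An equivalence relation `E` on `I`, positive integers `n x` (the orders of the finite cyclic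
groups `G x`), and a system of positive integers `m x y`, for `(x, y)` in `E`, that satisfies the
index conditions. (The values `m x y` for pairs outside `E` play no role.) -/
structure IndexSystem (I : Type u) where
  E : Setoid I
  n : I → ℕ
  n_pos : ∀ x, 0 < n x
  m : I → I → ℕ
  m_pos : ∀ x y, E x y → 0 < m x y
  dvd_left : ∀ x y, E x y → m x y ∣ n x
  dvd_right : ∀ x y, E x y → m x y ∣ n y
  m_self : ∀ x, m x x = n x
  m_symm : ∀ x y, E x y → m y x = m x y
  gcd_left : ∀ x y z, E x y → E y z → (m x y).gcd (m y z) = (m x y).gcd (m x z)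
  gcd_right : ∀ x y z, E x y → E y z → (m x y).gcd (m x z) = (m x z).gcd (m y z)

namespace IndexSystem

variable {I : Type u} (D : IndexSystem I)

/-- The cyclic group of order `n x`. -/
abbrev G (x : I) : Type := ZMod (D.n x)

/-- The disjoint union of the groups `G x`. -/
abbrev Base : Type u := Σ x : I, D.G x

/-- The subgroup of the multiples of `m x y` in `G x`. -/
def H (x y : I) : AddSubgroup (D.G x) := AddSubgroup.zmultiples ((D.m x y : ℕ) : D.G x)

/-- The subgroup of the multiples of `m x y` in `G y`. -/
def K (x y : I) : AddSubgroup (D.G y) := AddSubgroup.zmultiples ((D.m x y : ℕ) : D.G y)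

theorem dvd_cast {m a b : ℤ} (h : m ∣ a) (e : a = b) : m ∣ b := e ▸ h

theorem intCast_mem_zmultiples {n m : ℕ} (h : m ∣ n) (i : ℤ) :
    (i : ZMod n) ∈ AddSubgroup.zmultiples ((m : ℕ) : ZMod n) ↔ (m : ℤ) ∣ i := by
  rw [AddSubgroup.mem_zmultiples_iff]
  constructor
  · rintro ⟨k, hk⟩
    have h1 : ((k * m : ℤ) : ZMod n) = (i : ZMod n) := by
      rw [← hk]; push_cast; rw [zsmul_eq_mul]
    rw [ZMod.intCast_eq_intCast_iff_dvd_sub] at h1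
    have h2 : (m : ℤ) ∣ i - k * m := (Int.natCast_dvd_natCast.mpr h).trans h1
    have h3 := dvd_add h2 (Dvd.intro_left k rfl : (m : ℤ) ∣ k * m)
    simpa using h3
  · rintro ⟨k, rfl⟩
    refine ⟨k, ?_⟩
    rw [zsmul_eq_mul]; push_cast; ring

theorem mk_intCast_eq {n m : ℕ} (h : m ∣ n) (i j : ℤ) :
    (QuotientAddGroup.mk ((i : ℤ) : ZMod n) :
        ZMod n ⧸ AddSubgroup.zmultiples ((m : ℕ) : ZMod n)) =
      QuotientAddGroup.mk ((j : ℤ) : ZMod n) ↔ (m : ℤ) ∣ j - i := by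
  rw [QuotientAddGroup.eq, ← intCast_mem_zmultiples h]
  push_cast
  rw [neg_add_eq_sub]

/-- For common divisors `m` of `n` and `n'`, the homomorphism from `ℤ/n` modulo the multiples of
`m` to `ℤ/n'` modulo the multiples of `m` taking the coset of `ℓ` to the coset of `ℓ`. -/
def quotientHom (n n' m : ℕ) (h : m ∣ n) (h' : m ∣ n') :
    ZMod n ⧸ AddSubgroup.zmultiples ((m : ℕ) : ZMod n) →+
      ZMod n' ⧸ AddSubgroup.zmultiples ((m : ℕ) : ZMod n') :=
  QuotientAddGroup.lift _
    (ZMod.lift n ⟨(QuotientAddGroup.mk' (AddSubgroup.zmultiples ((m : ℕ) : ZMod n'))).comp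
        (Int.castAddHom (ZMod n')), by
      have := (mk_intCast_eq h' (n : ℤ) 0).mpr (by simpa using Int.natCast_dvd_natCast.mpr h)
      simpa using this⟩)
    (by
      rintro a ha
      obtain ⟨i, rfl⟩ := ZMod.intCast_surjective a
      have h1 := (intCast_mem_zmultiples h i).mp ha
      have h2 := (mk_intCast_eq h' i 0).mpr (by simpa using h1)
      simpa using h2)

theorem quotientHom_mk (n n' m : ℕ) (h : m ∣ n) (h' : m ∣ n') (i : ℤ) :
    quotientHom n n' m h h' (QuotientAddGroup.mk (i : ZMod n)) =
      QuotientAddGroup.mk (i : ZMod n') := by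
  simp [quotientHom]

/-- The quotient isomorphism `φ_xy` from `G x / H x y` to `G y / K x y` determined by
`φ_xy (H x y + ℓ) = K x y + ℓ`. -/
def φ {x y : I} (h : D.E x y) : D.G x ⧸ D.H x y ≃+ D.G y ⧸ D.K x y where
  toFun := quotientHom _ _ _ (D.dvd_left x y h) (D.dvd_right x y h)
  invFun := quotientHom _ _ _ (D.dvd_right x y h) (D.dvd_left x y h)
  left_inv a := by
    obtain ⟨b, rfl⟩ := QuotientAddGroup.mk_surjective a
    obtain ⟨i, rfl⟩ := ZMod.intCast_surjective b
    exact (congrArg _ (quotientHom_mk _ _ _ _ _ i)).trans (quotientHom_mk _ _ _ _ _ i)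
  right_inv a := by
    obtain ⟨b, rfl⟩ := QuotientAddGroup.mk_surjective a
    obtain ⟨i, rfl⟩ := ZMod.intCast_surjective b
    exact (congrArg _ (quotientHom_mk _ _ _ _ _ i)).trans (quotientHom_mk _ _ _ _ _ i)
  map_add' := map_add _

theorem φ_mk {x y : I} (h : D.E x y) (i : ℤ) :
    D.φ h (QuotientAddGroup.mk (i : D.G x)) = QuotientAddGroup.mk (i : D.G y) :=
  quotientHom_mk _ _ _ (D.dvd_left x y h) (D.dvd_right x y h) i

/-- The relation `R_{xy,α} = ⋃ γ, γ × φ_xy (γ + α)`, where `γ` ranges over the cosets of `H x y`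
in `G x`. -/
def R {x y : I} (h : D.E x y) (α : D.G x ⧸ D.H x y) : SetRel D.Base D.Base :=
  ⋃ γ : D.G x ⧸ D.H x y,
    {p | ∃ (a : D.G x) (b : D.G y), p = (⟨x, a⟩, ⟨y, b⟩) ∧
      (QuotientAddGroup.mk a : D.G x ⧸ D.H x y) = γ ∧
      (QuotientAddGroup.mk b : D.G y ⧸ D.K x y) = D.φ h (γ + α)}

/-- The index set of the relations `R_{xy,α}`. -/
abbrev Index : Type u := Σ p : {p : I × I // D.E p.1 p.2}, D.G p.1.1 ⧸ D.H p.1.1 p.1.2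

/-- The collection of all unions of relations `R_{xy,α}`. -/
def carrier : Set (SetRel D.Base D.Base) :=
  {T | ∃ X : Set D.Index, T = ⋃ t ∈ X, D.R t.1.2 t.2}

theorem mem_R {x y : I} (h : D.E x y) (x' y' : I) (i j l : ℤ) :
    (((⟨x', (i : D.G x')⟩, ⟨y', (j : D.G y')⟩) : D.Base × D.Base) ∈
      D.R h (QuotientAddGroup.mk (l : D.G x))) ↔
      x' = x ∧ y' = y ∧ (D.m x y : ℤ) ∣ j - i - l := by
  simp only [R, Set.mem_iUnion, Set.mem_ofPred_eq]
  constructor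
  · rintro ⟨γ, a, b, hp, rfl, hb⟩
    have h1 := (Prod.mk.injEq _ _ _ _).mp hp
    obtain ⟨h1, h2⟩ := h1
    cases h1
    cases h2
    refine ⟨rfl, rfl, ?_⟩
    rw [← QuotientAddGroup.mk_add, ← Int.cast_add, φ_mk] at hb
    have h3 := (mk_intCast_eq (D.dvd_right x y h) j (i + l)).mp hb
    have h4 := (dvd_neg (α := ℤ)).mpr h3
    exact dvd_cast h4 (by ring)
  · rintro ⟨rfl, rfl, hd⟩
    refine ⟨_, i, j, rfl, rfl, ?_⟩
    rw [← QuotientAddGroup.mk_add, ← Int.cast_add, φ_mk]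
    refine (mk_intCast_eq (D.dvd_right x' y' h) j (i + l)).mpr ?_
    have h4 := (dvd_neg (α := ℤ)).mpr hd
    exact dvd_cast h4 (by ring)

theorem mem_carrier_iff (T : SetRel D.Base D.Base) :
    T ∈ D.carrier ↔
      ∀ (x y : I) (i j : ℤ), ((⟨x, (i : D.G x)⟩, ⟨y, (j : D.G y)⟩) : D.Base × D.Base) ∈ T →
        D.E x y ∧ ∀ i' j' : ℤ, (D.m x y : ℤ) ∣ (j' - i') - (j - i) →
          ((⟨x, (i' : D.G x)⟩, ⟨y, (j' : D.G y)⟩) : D.Base × D.Base) ∈ T := by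
  constructor
  · rintro ⟨X, rfl⟩ x y i j hT
    simp only [Set.mem_iUnion] at hT
    obtain ⟨⟨⟨⟨x0, y0⟩, h⟩, α⟩, ht, hm⟩ := hT
    obtain ⟨a, rfl⟩ := QuotientAddGroup.mk_surjective α
    obtain ⟨l, rfl⟩ := ZMod.intCast_surjective a
    have hm' := (D.mem_R h x y i j l).mp hm
    obtain ⟨rfl, rfl, hd⟩ := hm'
    refine ⟨h, fun i' j' hd' => ?_⟩
    simp only [Set.mem_iUnion]
    refine ⟨_, ht, (D.mem_R h x y i' j' l).mpr ⟨rfl, rfl, ?_⟩⟩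
    have := dvd_add hd' hd
    exact dvd_cast this (by ring)
  · intro hT
    refine ⟨{t | D.R t.1.2 t.2 ⊆ T}, Set.Subset.antisymm ?_ ?_⟩
    · rintro ⟨⟨x, a⟩, ⟨y, b⟩⟩ hp
      obtain ⟨i, rfl⟩ := ZMod.intCast_surjective a
      obtain ⟨j, rfl⟩ := ZMod.intCast_surjective b
      obtain ⟨h, h'⟩ := hT x y i j hp
      simp only [Set.mem_iUnion]
      refine ⟨⟨⟨(x, y), h⟩, QuotientAddGroup.mk ((j - i : ℤ) : D.G x)⟩, ?_,
        (D.mem_R h x y i j (j - i)).mpr ⟨rfl, rfl, by simp⟩⟩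
      rintro ⟨⟨x', a⟩, ⟨y', b⟩⟩ hq
      obtain ⟨i', rfl⟩ := ZMod.intCast_surjective a
      obtain ⟨j', rfl⟩ := ZMod.intCast_surjective b
      have hq' := (D.mem_R h x' y' i' j' (j - i)).mp hq
      obtain ⟨rfl, rfl, hd⟩ := hq'
      exact h' i' j' hd
    · exact Set.iUnion₂_subset fun t ht => ht

/-- Two congruences are simultaneously solvable when they agree modulo the gcd. -/
theorem exists_solution (p q : ℕ) (a b : ℤ) (h : ((p.gcd q : ℕ) : ℤ) ∣ b - a) :
    ∃ c : ℤ, (p : ℤ) ∣ c - a ∧ (q : ℤ) ∣ c - b := by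
  obtain ⟨k, hk⟩ := h
  rw [Nat.gcd_eq_gcd_ab] at hk
  refine ⟨a + p * p.gcdA q * k, ⟨p.gcdA q * k, by ring⟩, ⟨-(p.gcdB q * k), ?_⟩⟩
  linear_combination -hk

/-- The cyclic group relation algebra determined by an index system. -/
def algebra : SetRelationAlgebra D.Base where
  carrier := D.carrier
  unit := {p | D.E p.1.1 p.2.1}
  unit_mem := (D.mem_carrier_iff _).mpr fun _ _ _ _ h => ⟨h, fun _ _ _ => h⟩
  subset_unit T hT := by
    rintro ⟨⟨x, a⟩, ⟨y, b⟩⟩ hp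
    obtain ⟨i, rfl⟩ := ZMod.intCast_surjective a
    obtain ⟨j, rfl⟩ := ZMod.intCast_surjective b
    exact ((D.mem_carrier_iff T).mp hT x y i j hp).1
  union_mem T hT V hV := by
    rw [mem_carrier_iff] at hT hV ⊢
    rintro x y i j (h | h)
    · exact ⟨(hT x y i j h).1, fun i' j' hd => Or.inl ((hT x y i j h).2 i' j' hd)⟩
    · exact ⟨(hV x y i j h).1, fun i' j' hd => Or.inr ((hV x y i j h).2 i' j' hd)⟩
  compl_mem T hT := by
    rw [mem_carrier_iff] at hT ⊢
    rintro x y i j ⟨h, h'⟩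
    refine ⟨h, fun i' j' hd => ⟨h, fun hc => h' ?_⟩⟩
    refine (hT x y i' j' hc).2 i j ?_
    have := (dvd_neg (α := ℤ)).mpr hd
    exact dvd_cast this (by ring)
  comp_mem T hT V hV := by
    rw [mem_carrier_iff] at hT hV ⊢
    rintro x z i k ⟨⟨y, b⟩, h, h'⟩
    obtain ⟨j, rfl⟩ := ZMod.intCast_surjective b
    obtain ⟨hxy, hT'⟩ := hT x y i j h
    obtain ⟨hyz, hV'⟩ := hV y z j k h'
    refine ⟨D.E.trans' hxy hyz, fun i' k' hd => ?_⟩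
    have hg : (((D.m x y).gcd (D.m y z) : ℕ) : ℤ) ∣ (k' - (k - j)) - (i' + (j - i)) := by
      have h1 : (((D.m x y).gcd (D.m y z) : ℕ) : ℤ) ∣ (D.m x z : ℤ) := by
        rw [D.gcd_left x y z hxy hyz]
        exact Int.natCast_dvd_natCast.mpr (Nat.gcd_dvd_right _ _)
      have h2 := h1.trans hd
      exact dvd_cast h2 (by ring)
    obtain ⟨c, hc1, hc2⟩ := exists_solution _ _ _ _ hg
    refine ⟨⟨y, (c : D.G y)⟩, hT' i' c ?_, hV' c k' ?_⟩
    · exact dvd_cast hc1 (by ring)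
    · have := (dvd_neg (α := ℤ)).mpr hc2
      exact dvd_cast this (by ring)
  inv_mem T hT := by
    rw [mem_carrier_iff] at hT ⊢
    intro x y i j h
    obtain ⟨hyx, hT'⟩ := hT y x j i h
    refine ⟨D.E.symm' hyx, fun i' j' hd => hT' j' i' ?_⟩
    rw [D.m_symm y x hyx] at hd
    have := (dvd_neg (α := ℤ)).mpr hd
    exact dvd_cast this (by ring)
  id_mem := by
    rw [mem_carrier_iff]
    intro x y i j h
    have h1 : (⟨x, (i : D.G x)⟩ : D.Base) = ⟨y, (j : D.G y)⟩ := h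
    obtain rfl : x = y := congrArg Sigma.fst h1
    have h2 : (i : D.G x) = (j : D.G x) := eq_of_heq (Sigma.mk.inj h1).2
    refine ⟨D.E.refl' x, fun i' j' hd => ?_⟩
    change (⟨x, (i' : D.G x)⟩ : D.Base) = ⟨x, (j' : D.G x)⟩
    rw [D.m_self] at hd
    have h3 := (ZMod.intCast_eq_intCast_iff_dvd_sub i j (D.n x)).mp h2
    have h4 : (i' : D.G x) = (j' : D.G x) := by
      refine (ZMod.intCast_eq_intCast_iff_dvd_sub i' j' (D.n x)).mpr ?_
      have := dvd_add hd h3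
      exact dvd_cast this (by ring)
    rw [h4]

end IndexSystem

end RelAlg

/-! For measurable atoms `x`, `y`, the elements of `G_x` are atoms, `G_x` and `G_y` act transitively
on the atoms below `x;1;y` by left and right translation, and finiteness of `G_x` makes this
rectangle atomic (`exists_eq_comp`, `exists_atom_le`). Fix generators `g_x`. An atom `a` below
`x;1;y` has a period `m_xy` under right translation by `g_y`, and `g_x;a = a;g_y^u` with an exponent
`u = u_xy`; neither depends on `a`. So the rectangle looks like a block of a cyclic group relation
algebra, and `gcd_dvd_m` yields the gcd conditions on `m`.

To glue the blocks together, two families of choices must be made coherent. The generators are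
replaced by powers so that all `u_xy` become 1 (`exists_coherent`). Then one atom `α x y` is chosen
in each nonzero rectangle so that `α x z ≤ α x y;α y z` always holds (`exists_scaffold`). Both
choices run along a well-order of the measurable atoms. Each step is a possibly infinite system of
congruences whose moduli divide one positive integer; pairwise compatibility suffices to solve it
(`exists_solution_of_dvd`), and compatibility comes from `gcd_dvd_of_le_comp`: two atoms below `a;b`
differ by a multiple of `gcd(m_xy, m_yz)`.

With a scaffold, the pair (`i`th point over `x`, `j`th point over `y`) is labelled by the atom `α x
y;g_y^(j-i)`, and an element `r` is represented by the pairs whose label is below `r`. Since labels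
are atoms, suprema go to unions. The image is dense in the cyclic group relation algebra, which is
therefore the completion, and the image itself is a complete representation. -/

namespace RelAlg
namespace RelationAlgebra

/-! ### Cycle laws and atoms. -/

section Arithmetic

variable {A : Type u} [RelationAlgebra A]

theorem bot_comp (a : A) : comp ⊥ a = ⊥ := by
  have h := congrArg conv (comp_bot (conv a))
  rwa [conv_comp, conv_conv, conv_bot] at h

/-- Tarski's last axiom in symmetric form: translation by `a` and by `conv a` are conjugate. One
implication applied to `conv a` is the other. -/
theorem disjoint_comp_left {a b c : A} :
    Disjoint (comp a b) c ↔ Disjoint b (comp (conv a) c) := by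
  have key : ∀ {a b c : A}, Disjoint (comp a b) c → Disjoint b (comp (conv a) c) := by
    intro a b c h
    exact (le_compl_iff_disjoint_right.mp (cycle (le_compl_iff_disjoint_right.mpr h))).symm
  refine ⟨key, fun h => ?_⟩
  have h1 := key h.symm
  rw [conv_conv] at h1
  exact h1.symm

theorem disjoint_conv {a b : A} : Disjoint (conv a) (conv b) ↔ Disjoint a b := by
  have key : ∀ {a b : A}, Disjoint a b → Disjoint (conv a) (conv b) := by
    intro a b h c h1 h2
    have h3 := h (show conv c ≤ a by simpa only [conv_conv] using conv_mono h1)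
      (show conv c ≤ b by simpa only [conv_conv] using conv_mono h2)
    have h4 := conv_mono h3
    rwa [conv_conv, conv_bot] at h4
  refine ⟨fun h => ?_, key⟩
  simpa only [conv_conv] using key h

theorem disjoint_comp_right {a b c : A} :
    Disjoint (comp a b) c ↔ Disjoint a (comp c (conv b)) := by
  rw [← disjoint_conv, conv_comp, disjoint_comp_left, ← disjoint_conv (a := a), conv_comp]

theorem conv_ne_bot {a : A} (h : a ≠ ⊥) : conv a ≠ ⊥ := by
  intro h'
  apply h
  rw [← conv_conv a, h', conv_bot]

theorem conv_le_conv {a b : A} : conv a ≤ conv b ↔ a ≤ b :=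
  ⟨fun h => by simpa only [conv_conv] using conv_mono h, conv_mono⟩

theorem isAtom_conv {a : A} (h : IsAtom a) : IsAtom (conv a) := by
  refine ⟨conv_ne_bot h.1, fun b hb => ?_⟩
  have h1 : conv b < a := by
    refine lt_of_le_not_ge (by simpa only [conv_conv] using conv_mono hb.le) fun h2 => ?_
    exact hb.not_ge (by simpa only [conv_conv] using conv_mono h2)
  have h2 := h.2 _ h1
  rw [← conv_conv b, h2, conv_bot]

theorem _root_.IsAtom.le_of_not_disjoint {α : Type*} [SemilatticeInf α] [OrderBot α] {a b : α}
    (ha : IsAtom a) (h : ¬ Disjoint a b) : a ≤ b := by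
  rcases ha.le_iff.mp (inf_le_left : a ⊓ b ≤ a) with h1 | h1
  · exact absurd (disjoint_iff.mpr h1) h
  · exact inf_eq_left.mp h1

theorem _root_.IsAtom.not_disjoint_of_le {α : Type*} [SemilatticeInf α] [OrderBot α] {a b : α}
    (ha : IsAtom a) (h : a ≤ b) : ¬ Disjoint a b :=
  fun hd => ha.1 (le_bot_iff.mp (hd le_rfl h))

theorem _root_.IsAtom.eq_of_le {α : Type*} [PartialOrder α] [OrderBot α] {a b : α}
    (ha : IsAtom a) (hb : IsAtom b) (h : a ≤ b) : a = b :=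
  (hb.le_iff.mp h).resolve_left ha.1

/-- The left cycle law for atoms. -/
theorem atom_cycle_left {a b c : A} (hb : IsAtom b) (hc : IsAtom c) (h : c ≤ comp a b) :
    b ≤ comp (conv a) c := by
  refine hb.le_of_not_disjoint fun hd => ?_
  exact hc.not_disjoint_of_le h (disjoint_comp_left.mpr hd).symm

/-- The right cycle law for atoms. -/
theorem atom_cycle_right {a b c : A} (ha : IsAtom a) (hc : IsAtom c) (h : c ≤ comp a b) :
    a ≤ comp c (conv b) := by
  refine ha.le_of_not_disjoint fun hd => ?_
  exact hc.not_disjoint_of_le h (disjoint_comp_right.mpr hd).symm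

end Arithmetic

/-! ### Elements of a rectangle `x;1;y`. -/

section Typed

variable {A : Type u} [RelationAlgebra A]

/-- The element `a` is below the rectangle `x;1;y`. -/
def Typed (x y a : A) : Prop := comp x a = a ∧ comp a y = a

theorem comp_eq_of_le_left {x a b : A} (hx : x ≤ ident) (ha : comp x a = a) (h : b ≤ a) :
    comp x b = b := by
  apply le_antisymm
  · exact (comp_mono_left _ hx).trans (ident_comp b).le
  · have h1 := modular x a b
    rw [ha, inf_eq_right.mpr h, conv_eq_self hx] at h1
    exact h1.trans (comp_mono_right _ inf_le_right |>.trans (by rw [comp_assoc, comp_self hx]))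

theorem comp_eq_of_le_right {x a b : A} (hx : x ≤ ident) (ha : comp a x = a) (h : b ≤ a) :
    comp b x = b := by
  have h1 : comp x (conv a) = conv a := by
    have := congrArg conv ha
    rwa [conv_comp, conv_eq_self hx] at this
  have h2 := congrArg conv (comp_eq_of_le_left hx h1 (conv_mono h))
  rwa [conv_comp, conv_conv, conv_eq_self hx] at h2

namespace Typed

variable {x y z a b : A}

theorem mono (hx : x ≤ ident) (hy : y ≤ ident) (h : Typed x y a) (hb : b ≤ a) : Typed x y b :=
  ⟨comp_eq_of_le_left hx h.1 hb, comp_eq_of_le_right hy h.2 hb⟩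

theorem comp (h : Typed x y a) (h' : Typed y z b) : Typed x z (comp a b) :=
  ⟨by rw [comp_assoc, h.1], by rw [← comp_assoc, h'.2]⟩

theorem conv (hx : x ≤ ident) (hy : y ≤ ident) (h : Typed x y a) : Typed y x (conv a) :=
  ⟨by rw [← conv_eq_self hy, ← conv_comp, h.2], by rw [← conv_eq_self hx, ← conv_comp, h.1]⟩

theorem self (hx : x ≤ ident) : Typed x x x := ⟨comp_self hx, comp_self hx⟩

theorem le_square (h : Typed x x a) : a ≤ square x := by
  rw [← h.2, ← h.1]
  exact comp_mono_left _ (comp_mono_right _ le_top)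

theorem of_le_square (hx : x ≤ ident) (h : a ≤ square x) : Typed x x a :=
  ⟨comp_of_le_square hx h, comp_of_le_square' hx h⟩

/-- If `y` were disjoint from `conv a;a`, the cycle law would make `a;y = a` disjoint from itself.
-/
theorem le_conv_comp (hy : IsAtom y) (h : Typed x y a) (ha : a ≠ ⊥) :
    y ≤ RelationAlgebra.comp (RelationAlgebra.conv a) a := by
  refine hy.le_of_not_disjoint fun hd => ha ?_
  have h1 := disjoint_comp_left.mpr hd
  rw [h.2] at h1
  exact disjoint_self.mp h1

theorem comp_ne_bot (hy : IsAtom y) (h : Typed x y a) (h' : Typed y z b) (ha : a ≠ ⊥)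
    (hb : b ≠ ⊥) : RelationAlgebra.comp a b ≠ ⊥ := by
  intro h0
  apply hb
  have h1 : b ≤ RelationAlgebra.comp (RelationAlgebra.comp (RelationAlgebra.conv a) a) b := by
    conv_lhs => rw [← h'.1]
    exact comp_mono_left _ (h.le_conv_comp hy ha)
  rw [← comp_assoc, h0, comp_bot] at h1
  exact le_bot_iff.mp h1

end Typed

end Typed

/-! ### Translation action of the groups `G_x` on rectangles. -/

section MeasurableAtoms

variable {A : Type u} [RelationAlgebra A]

variable (A) in
/-- The type of measurable atoms. -/
abbrev MAtom : Type u := {x : A // IsMeasurableAtom x}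

variable {x y z : MAtom A}

theorem AtomGroup.typed (f : AtomGroup x) : Typed x.1 x.1 f.1 :=
  Typed.of_le_square x.2.le_ident f.2.2.1

theorem AtomGroup.conv_comp_self (f : AtomGroup x) : comp (conv f.1) f.1 = x.1 :=
  conv_comp_self_eq x.2.isAtom x.2.le_ident f.2

theorem AtomGroup.comp_conv_self (f : AtomGroup x) : comp f.1 (conv f.1) = x.1 := by
  have h := AtomGroup.conv_comp_self f⁻¹
  change comp (conv (conv f.1)) (conv f.1) = x.1 at h
  rwa [conv_conv] at h

/-- Left translation by `f` is invertible on the elements fixed by `x`, with inverse translation by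
`conv f`, so it preserves atoms. -/
theorem AtomGroup.isAtom_comp (f : AtomGroup x) {a : A} (ha : IsAtom a)
    (hx : comp x.1 a = a) : IsAtom (comp f.1 a) := by
  have hne : ∀ b : A, comp f.1 b = ⊥ → comp x.1 b = ⊥ := by
    intro b hb
    rw [← f.conv_comp_self, ← comp_assoc, hb, comp_bot]
  refine ⟨fun h => ha.1 (by rw [← hx, hne a h]), fun b hb => ?_⟩
  have h1 : comp x.1 b = b := by
    refine comp_eq_of_le_left x.2.le_ident ?_ hb.le
    rw [comp_assoc, f.typed.1]
  have h2 : comp (conv f.1) b ≤ a := by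
    refine (comp_mono_right _ hb.le).trans ?_
    rw [comp_assoc, f.conv_comp_self, hx]
  have h3 : comp f.1 (comp (conv f.1) b) = b := by
    rw [comp_assoc, f.comp_conv_self, h1]
  rcases ha.le_iff.mp h2 with h4 | h4
  · rw [← h3, h4, comp_bot]
  · rw [h4] at h3
    exact absurd h3.symm hb.ne

theorem AtomGroup.isAtom (f : AtomGroup x) : IsAtom f.1 := by
  have h := f.isAtom_comp x.2.isAtom (comp_self x.2.le_ident)
  rwa [f.typed.2] at h

theorem AtomGroup.isAtom_comp_right (f : AtomGroup y) {a : A} (ha : IsAtom a)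
    (hy : comp a y.1 = a) : IsAtom (comp a f.1) := by
  have h : comp y.1 (conv a) = conv a := by
    rw [← conv_eq_self y.2.le_ident, ← conv_comp, hy]
  have h1 := isAtom_conv ((f⁻¹).isAtom_comp (isAtom_conv ha) h)
  change IsAtom (conv (comp (conv f.1) (conv a))) at h1
  rwa [← conv_comp, conv_conv] at h1

/-- The elements of `G_x` cover the square on `x`. -/
theorem exists_atomGroup_le {b c : A} (hb : Typed x.1 x.1 b) (h : ¬ Disjoint b c) :
    ∃ f : AtomGroup x, f.1 ≤ b ∧ f.1 ≤ c := by
  by_contra! hcon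
  apply h
  have h1 : square x.1 ≤ (b ⊓ c)ᶜ := by
    refine x.2.isLUB.2 fun f hf => ?_
    refine le_compl_iff_disjoint_right.mpr ?_
    by_contra hd
    have h2 := (AtomGroup.isAtom (⟨f, hf⟩ : AtomGroup x)).le_of_not_disjoint hd
    exact hcon ⟨f, hf⟩ (h2.trans inf_le_left) (h2.trans inf_le_right)
  have h2 := le_compl_iff_disjoint_right.mp 
    (((inf_le_left : b ⊓ c ≤ b).trans hb.le_square).trans h1)
  exact disjoint_iff.mpr (disjoint_self.mp h2)

/-- `G_x` acts transitively on the atoms below `x;1;y`. -/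
theorem exists_eq_comp {a b : A} (ha : IsAtom a) (hb : IsAtom b) (hta : Typed x.1 y.1 a)
    (htb : Typed x.1 y.1 b) : ∃ f : AtomGroup x, b = comp f.1 a := by
  have hac := hta.conv x.2.le_ident y.2.le_ident
  have h0 := htb.comp_ne_bot y.2.isAtom hac hb.1 (conv_ne_bot ha.1)
  obtain ⟨f, hf, -⟩ := exists_atomGroup_le (htb.comp hac) (fun h => h0 (disjoint_self.mp h))
  -- The atom `f` lies below `b;conv a`, so the cycle law puts `b` below `f;a`, which is also an
  -- atom.
  have h1 := atom_cycle_right hb f.isAtom hf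
  rw [conv_conv] at h1
  exact ⟨f, hb.eq_of_le (f.isAtom_comp ha hta.1) h1⟩

theorem exists_eq_comp_right {a b : A} (ha : IsAtom a) (hb : IsAtom b) (hta : Typed x.1 y.1 a)
    (htb : Typed x.1 y.1 b) : ∃ f : AtomGroup y, b = comp a f.1 := by
  obtain ⟨f, hf⟩ := exists_eq_comp (isAtom_conv ha) (isAtom_conv hb)
    (hta.conv x.2.le_ident y.2.le_ident) (htb.conv x.2.le_ident y.2.le_ident)
  refine ⟨f⁻¹, ?_⟩
  have h := congrArg conv hf
  rwa [conv_conv, conv_comp, conv_conv] at h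

/-- If `G_x` is finite, then the rectangle `x;1;y` is atomic. -/
theorem exists_atom_le [Finite (AtomGroup x)] {a : A} (hta : Typed x.1 y.1 a) (ha : a ≠ ⊥) :
    ∃ b, IsAtom b ∧ b ≤ a := by
  -- `S b` consists of the `f` for which `f;b` meets `b`. A nonzero `b ≤ a` with `S b` of least size
  -- is an atom. Otherwise it splits into `c` and `b ⊓ cᶜ`, and some `f` in `S b` carries a nonzero
  -- `d ≤ c` into `b ⊓ cᶜ`. Then `f;d` misses `d`, although minimality gives `S d = S b`.
  let S : A → Set (AtomGroup x) := fun b => {f | f.1 ≤ comp b (conv b)}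
  have hS : ∀ {b c : A}, b ≤ c → S b ⊆ S c := fun h f hf =>
    le_trans hf (comp_mono h (conv_mono h))
  let P : ℕ → Prop := fun n => ∃ b, b ≠ ⊥ ∧ b ≤ a ∧ (S b).ncard = n
  have hP : ∃ n, P n := ⟨_, a, ha, le_rfl, rfl⟩
  classical
  obtain ⟨b, hb0, hba, hbn⟩ := Nat.find_spec hP
  have hmin : ∀ c, c ≠ ⊥ → c ≤ b → S c = S b := by
    intro c hc hcb
    refine Set.eq_of_subset_of_ncard_le (hS hcb) ?_ (Set.toFinite _)
    rw [hbn]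
    exact Nat.find_min' hP ⟨c, hc, hcb.trans hba, rfl⟩
  refine ⟨b, ⟨hb0, fun c hc => ?_⟩, hba⟩
  by_contra hc0
  have htb := hta.mono x.2.le_ident y.2.le_ident hba
  have htc := htb.mono x.2.le_ident y.2.le_ident hc.le
  have hd0 : b ⊓ cᶜ ≠ ⊥ := fun h =>
    hc.not_ge (by
      have := disjoint_iff.mpr h
      rwa [disjoint_compl_right_iff] at this)
  have htd := htb.mono x.2.le_ident y.2.le_ident (inf_le_left : b ⊓ cᶜ ≤ b)
  have hcc := htc.conv x.2.le_ident y.2.le_ident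
  have h0 := htd.comp_ne_bot y.2.isAtom hcc hd0 (conv_ne_bot hc0)
  obtain ⟨f, hf, -⟩ := exists_atomGroup_le (htd.comp hcc) (fun h => h0 (disjoint_self.mp h))
  have h1 : ¬ Disjoint (comp (conv f.1) (b ⊓ cᶜ)) c := by
    intro hd
    rw [disjoint_comp_left, conv_conv, disjoint_comm, disjoint_comp_right] at hd
    exact f.isAtom.not_disjoint_of_le hf hd
  set d := comp (conv f.1) (b ⊓ cᶜ) ⊓ c with hdd
  have hd1 : d ≠ ⊥ := fun h => h1 (disjoint_iff.mpr h)
  have hfb : f ∈ S b := le_trans hf (comp_mono inf_le_left (conv_mono hc.le))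
  rw [← hmin d hd1 (inf_le_right.trans hc.le)] at hfb
  have h2 : ¬ Disjoint (comp f.1 d) d := by
    rw [disjoint_comp_right]
    exact f.isAtom.not_disjoint_of_le hfb
  apply h2
  have h3 : comp f.1 d ≤ cᶜ := by
    refine (comp_mono_right _ inf_le_left).trans ?_
    rw [comp_assoc, f.comp_conv_self, htd.1]
    exact inf_le_right
  exact Disjoint.mono h3 inf_le_right disjoint_compl_left

end MeasurableAtoms

end RelationAlgebra
/-! ### Choices along a well-founded relation -/

/-- Recursion for choices that depend on earlier ones: `Q p` only looks at values at or below `p`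
(`hloc`), and any choice that is correct below `p` admits a good value at `p` (`hstep`). -/
theorem exists_forall_of_wellFounded {P : Type v} {T : Type w} [Nonempty T] {lt : P → P → Prop}
    (wf : WellFounded lt) (htrans : ∀ {p q r}, lt p q → lt q r → lt p r)
    (Q : P → (P → T) → Prop)
    (hloc : ∀ p f g, (∀ q, lt q p ∨ q = p → f q = g q) → Q p f → Q p g)
    (hstep : ∀ p f, (∀ q, lt q p → Q q f) → ∃ t, Q p (fun q => open Classical in
      if q = p then t else f q)) :
    ∃ f, ∀ p, Q p f := by
  classical
  -- Filler for points not below `p`; by `hloc` it never influences `Q p`.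
  let t₀ : T := Classical.arbitrary T
  let step : ∀ p, (∀ q, lt q p → T) → T := fun p rec =>
    if h : ∃ t, Q p (fun q => if q = p then t else if h : lt q p then rec q h else t₀) then
      h.choose else t₀
  let F : P → T := wf.fix step
  have hF : ∀ p, F p = step p (fun q _ => F q) := fun p => wf.fix_eq step p
  refine ⟨F, fun p => ?_⟩
  induction p using wf.induction with
  | _ p ih =>
    have irr : ¬ lt p p := fun h => wf.irrefl.irrefl p h
    have h1 : ∃ t, Q p (fun q => if q = p then t else if _h : lt q p then F q else t₀) := by
      have h2 := hstep p (fun q => if _h : lt q p then F q else t₀) fun q hq => by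
        refine hloc q F _ (fun r hr => ?_) (ih q hq)
        have hrp : lt r p := by
          rcases hr with hr | rfl
          exacts [htrans hr hq, hq]
        simp [hrp]
      convert h2
    have h3 : F p = h1.choose := by
      rw [hF]
      exact dif_pos h1
    refine hloc p _ F (fun q hq => ?_) h1.choose_spec
    rcases hq with hq | rfl
    · have hne : q ≠ p := fun h => irr (h ▸ hq)
      simp [hne, hq]
    · simp [h3]

/-! ### Simultaneous congruences -/

/-- Distributivity of gcd over lcm, checked on prime powers: one that divides the lcm divides `a` or
`b`. -/
theorem gcd_lcm_dvd {a b c : ℕ} (ha : a ≠ 0) (hb : b ≠ 0) {k : ℤ}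
    (h1 : ((a.gcd c : ℕ) : ℤ) ∣ k) (h2 : ((b.gcd c : ℕ) : ℤ) ∣ k) :
    (((a.lcm b).gcd c : ℕ) : ℤ) ∣ k := by
  rw [Int.natCast_dvd] at *
  rw [Nat.dvd_iff_prime_pow_dvd_dvd]
  intro p e hp h
  have hl := h.trans (Nat.gcd_dvd_left _ _)
  have hc := h.trans (Nat.gcd_dvd_right _ _)
  rw [hp.pow_dvd_iff_le_factorization (Nat.lcm_ne_zero ha hb), Nat.factorization_lcm ha hb,
    Finsupp.sup_apply, le_sup_iff] at hl
  rcases hl with hl | hl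
  · exact (Nat.dvd_gcd ((hp.pow_dvd_iff_le_factorization ha).mpr hl) hc).trans h1
  · exact (Nat.dvd_gcd ((hp.pow_dvd_iff_le_factorization hb).mpr hl) hc).trans h2

theorem finset_lcm_ne_zero {ι : Type*} (S : Finset ι) (d : ι → ℕ) (hd : ∀ s, d s ≠ 0) :
    S.lcm d ≠ 0 := by
  intro h
  rw [Finset.lcm_eq_zero_iff] at h
  obtain ⟨s, -, hs⟩ := h
  exact hd s hs

theorem gcd_finset_lcm_dvd {ι : Type*} (S : Finset ι) (d : ι → ℕ) (hd : ∀ s, d s ≠ 0) (c : ℕ)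
    {k : ℤ} (h : ∀ s ∈ S, (((d s).gcd c : ℕ) : ℤ) ∣ k) :
    (((S.lcm d).gcd c : ℕ) : ℤ) ∣ k := by
  classical
  induction S using Finset.induction_on with
  | empty => simp
  | insert s S hs ih =>
    rw [Finset.lcm_insert]
    exact gcd_lcm_dvd (hd s) (finset_lcm_ne_zero S d hd) (h s (Finset.mem_insert_self s S))
      (ih fun t ht => h t (Finset.mem_insert_of_mem ht))

/-- Chinese remainder theorem for moduli that need not be coprime. In the induction, the congruences
already solved become a single one modulo their lcm. -/
theorem exists_solution_finset {ι : Type*} (S : Finset ι) (d : ι → ℕ) (hd : ∀ s, d s ≠ 0)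
    (r : ι → ℤ) (h : ∀ s ∈ S, ∀ t ∈ S, (((d s).gcd (d t) : ℕ) : ℤ) ∣ r s - r t) :
    ∃ k : ℤ, ∀ s ∈ S, (d s : ℤ) ∣ k - r s := by
  classical
  induction S using Finset.induction_on with
  | empty => exact ⟨0, by simp⟩
  | insert s S hs ih =>
    obtain ⟨k, hk⟩ := ih fun t ht t' ht' =>
      h t (Finset.mem_insert_of_mem ht) t' (Finset.mem_insert_of_mem ht')
    have h1 : (((S.lcm d).gcd (d s) : ℕ) : ℤ) ∣ r s - k := by
      refine gcd_finset_lcm_dvd S d hd _ fun t ht => ?_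
      have h2 := h s (Finset.mem_insert_self s S) t (Finset.mem_insert_of_mem ht)
      rw [Nat.gcd_comm] at h2
      have h3 := (Int.natCast_dvd_natCast.mpr (Nat.gcd_dvd_left (d t) (d s))).trans (hk t ht)
      have h4 := dvd_sub h2 h3
      rwa [show r s - r t - (k - r t) = r s - k by ring] at h4
    obtain ⟨c, hc1, hc2⟩ := IndexSystem.exists_solution _ _ _ _ h1
    refine ⟨c, fun t ht => ?_⟩
    rcases Finset.mem_insert.mp ht with rfl | ht
    · exact hc2
    · have h5 := (Int.natCast_dvd_natCast.mpr (Finset.dvd_lcm ht)).trans hc1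
      have h6 := dvd_add h5 (hk t ht)
      rwa [show c - k + (k - r t) = c - r t by ring] at h6

/-- A family of pairwise compatible congruences, whose moduli divide a fixed positive integer,
reduces to a finite one. -/
theorem exists_finite_subfamily {ι : Type*} {n : ℕ} (hn : n ≠ 0) (d : ι → ℕ)
    (hd : ∀ s, d s ∣ n) (r : ι → ℤ)
    (h : ∀ s t, (((d s).gcd (d t) : ℕ) : ℤ) ∣ r s - r t) :
    ∃ S : Finset ι, ∀ k : ℤ, (∀ s ∈ S, (d s : ℤ) ∣ k - r s) → ∀ s, (d s : ℤ) ∣ k - r s := by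
  classical
  have hfin : (Set.range d).Finite :=
    (Nat.divisors n).finite_toSet.subset (by
      rintro _ ⟨s, rfl⟩
      exact Nat.mem_divisors.mpr ⟨hd s, hn⟩)
  rcases isEmpty_or_nonempty ι with hι | hι
  · exact ⟨∅, fun k _ s => isEmptyElim s⟩
  -- One index for each modulus is enough: the compatibility condition for equal moduli says that
  -- the residues agree modulo that modulus.
  choose! σ hσ using fun (e : ℕ) (he : e ∈ Set.range d) => he
  refine ⟨hfin.toFinset.image σ, fun k hk s => ?_⟩
  have h1 := hk (σ (d s)) (Finset.mem_image_of_mem _ (hfin.mem_toFinset.mpr ⟨s, rfl⟩))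
  have h2 := h (σ (d s)) s
  rw [hσ (d s) ⟨s, rfl⟩] at h1 h2
  rw [Nat.gcd_self] at h2
  have h3 := dvd_add h1 h2
  rwa [sub_add_sub_cancel] at h3

theorem exists_solution_of_dvd {ι : Type*} {n : ℕ} (hn : n ≠ 0) (d : ι → ℕ)
    (hd : ∀ s, d s ∣ n) (r : ι → ℤ)
    (h : ∀ s t, (((d s).gcd (d t) : ℕ) : ℤ) ∣ r s - r t) :
    ∃ k : ℤ, ∀ s, (d s : ℤ) ∣ k - r s := by
  obtain ⟨S, hS⟩ := exists_finite_subfamily hn d hd r h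
  obtain ⟨k, hk⟩ := exists_solution_finset S d (fun s => ne_zero_of_dvd_ne_zero hn (hd s)) r
    fun s _ t _ => h s t
  exact ⟨k, hS k hk⟩

theorem isCoprime_of_dvd_sub {a b d : ℤ} (h : d ∣ a - b) (hb : IsCoprime b d) :
    IsCoprime a d := by
  obtain ⟨c, hc⟩ := h
  rw [show a = b + d * c by linarith]
  exact IsCoprime.add_mul_left_left hb c

/-- Units modulo `l` lift to units modulo `n`. -/
theorem exists_coprime_lift {n l : ℕ} (hn : n ≠ 0) (hl : l ∣ n) {k : ℤ}
    (hk : IsCoprime k (l : ℤ)) : ∃ k' : ℤ, IsCoprime k' (n : ℤ) ∧ (l : ℤ) ∣ k' - k := by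
  have : NeZero n := ⟨hn⟩
  obtain ⟨u, hu⟩ := (ZMod.coe_int_isUnit_iff_isCoprime k l).mpr hk.symm
  obtain ⟨w, hw⟩ := ZMod.unitsMap_surjective hl u
  obtain ⟨i, hi⟩ := ZMod.intCast_surjective (w : ZMod n)
  refine ⟨i, ((ZMod.coe_int_isUnit_iff_isCoprime i n).mp ⟨w, hi.symm⟩).symm, ?_⟩
  have h1 : (ZMod.castHom hl (ZMod l)) (w : ZMod n) = (u : ZMod l) := by
    rw [← hw]
    rfl
  rw [← hi, map_intCast, hu] at h1
  exact (ZMod.intCast_eq_intCast_iff_dvd_sub k i l).mp h1.symm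

/-- Any solution is coprime to each modulus, hence to the lcm of a finite determining subfamily; a
change by a multiple of that lcm makes it coprime to `n`. -/
theorem exists_coprime_solution_of_dvd {ι : Type*} {n : ℕ} (hn : n ≠ 0) (d : ι → ℕ)
    (hd : ∀ s, d s ∣ n) (r : ι → ℤ) (hr : ∀ s, IsCoprime (r s) (d s : ℤ))
    (h : ∀ s t, (((d s).gcd (d t) : ℕ) : ℤ) ∣ r s - r t) :
    ∃ k : ℤ, IsCoprime k (n : ℤ) ∧ ∀ s, (d s : ℤ) ∣ k - r s := by
  obtain ⟨S, hS⟩ := exists_finite_subfamily hn d hd r h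
  obtain ⟨k, hk⟩ := exists_solution_of_dvd hn d hd r h
  have hc : IsCoprime k ((S.lcm d : ℕ) : ℤ) := by
    have h1 : IsCoprime k (∏ s ∈ S, (d s : ℤ)) :=
      IsCoprime.prod_right fun s _ => isCoprime_of_dvd_sub (hk s) (hr s)
    refine h1.of_isCoprime_of_dvd_right ?_
    rw [← Nat.cast_prod]
    exact Int.natCast_dvd_natCast.mpr (Finset.lcm_dvd_prod S d)
  obtain ⟨k', hk', hl⟩ := exists_coprime_lift hn (Finset.lcm_dvd fun s _ => hd s) hc
  refine ⟨k', hk', hS k' fun s hs => ?_⟩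
  have h2 := dvd_add ((Int.natCast_dvd_natCast.mpr (Finset.dvd_lcm hs)).trans hl) (hk s)
  rwa [sub_add_sub_cancel] at h2

namespace RelationAlgebra

/-! ### Generators, periods `m` and exponents `u`. -/

section Generators

variable {A : Type u} [RelationAlgebra A]

/-- The powers of a system of elements of the groups `G_x`. -/
def gpow (g : ∀ x : MAtom A, AtomGroup x) (x : MAtom A) (k : ℤ) : A := (g x ^ k).1

theorem gpow_zero (g : ∀ x : MAtom A, AtomGroup x) (x : MAtom A) : gpow g x 0 = x.1 := by
  rw [gpow, zpow_zero]
  rfl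

theorem gpow_add (g : ∀ x : MAtom A, AtomGroup x) (x : MAtom A) (i j : ℤ) :
    gpow g x (i + j) = comp (gpow g x i) (gpow g x j) := by
  rw [gpow, zpow_add]
  rfl

theorem conv_gpow (g : ∀ x : MAtom A, AtomGroup x) (x : MAtom A) (i : ℤ) :
    conv (gpow g x i) = gpow g x (-i) := by
  rw [gpow, gpow, zpow_neg]
  rfl

theorem typed_gpow (g : ∀ x : MAtom A, AtomGroup x) (x : MAtom A) (i : ℤ) :
    Typed x.1 x.1 (gpow g x i) := (g x ^ i).typed

theorem comp_gpow_comp_gpow (g : ∀ x : MAtom A, AtomGroup x) (x : MAtom A) (a : A) (i j : ℤ) :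
    comp (comp a (gpow g x i)) (gpow g x j) = comp a (gpow g x (i + j)) := by
  rw [gpow_add, comp_assoc]

theorem gpow_comp_gpow_comp (g : ∀ x : MAtom A, AtomGroup x) (x : MAtom A) (a : A) (i j : ℤ) :
    comp (gpow g x i) (comp (gpow g x j) a) = comp (gpow g x (i + j)) a := by
  rw [gpow_add, comp_assoc]

variable (A) in
/-- A choice of generators `gen x` of the groups `G_x`, together with integers `m x y` and
`u x y` such that an atom `a` below `x;1;y` is stabilized by `(gen y) ^ k` just in case `m x y`
divides `k`, and such that left translation of `a` by `gen x` is right translation by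
`(gen y) ^ u x y`. -/
structure GeneratorSystem where
  gen : ∀ x : MAtom A, AtomGroup x
  exists_zpow : ∀ (x : MAtom A) (f : AtomGroup x), ∃ k : ℤ, f = gen x ^ k
  finite : ∀ x : MAtom A, Finite (AtomGroup x)
  m : MAtom A → MAtom A → ℕ
  comp_gpow_eq_self : ∀ (x y : MAtom A) (a : A), IsAtom a → Typed x.1 y.1 a → ∀ k : ℤ,
    comp a (gpow gen y k) = a ↔ (m x y : ℤ) ∣ k
  u : MAtom A → MAtom A → ℤ
  gpow_comp : ∀ (x y : MAtom A) (a : A), IsAtom a → Typed x.1 y.1 a → ∀ k : ℤ,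
    comp (gpow gen x k) a = comp a (gpow gen y (u x y * k))

/-- Right translation by the powers of a fixed element has a period. -/
theorem exists_period (g : ∀ x : MAtom A, AtomGroup x) (y : MAtom A) (a : A)
    (ha : comp a y.1 = a) :
    ∃ m : ℕ, ∀ k : ℤ, comp a (gpow g y k) = a ↔ (m : ℤ) ∣ k := by
  let H : AddSubgroup ℤ :=
    { carrier := {k | comp a (gpow g y k) = a}
      zero_mem' := by
        change comp a (gpow g y 0) = a
        rw [gpow_zero, ha]
      add_mem' := by
        intro i j hi hj
        change comp a (gpow g y i) = a at hi
        change comp a (gpow g y j) = a at hj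
        change comp a (gpow g y (i + j)) = a
        rw [← comp_gpow_comp_gpow, hi, hj]
      neg_mem' := by
        intro i hi
        change comp a (gpow g y i) = a at hi
        change comp a (gpow g y (-i)) = a
        conv_lhs => rw [← hi]
        rw [comp_gpow_comp_gpow, add_neg_cancel, gpow_zero, ha] }
  obtain ⟨n, hn⟩ := Int.subgroup_cyclic H
  refine ⟨n.natAbs, fun k => ?_⟩
  have h1 : k ∈ H ↔ n ∣ k := by
    rw [hn, ← AddSubgroup.zmultiples_eq_closure, Int.mem_zmultiples_iff]
  rw [Int.natAbs_dvd]
  exact h1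

theorem gpow_comp_eq {g : ∀ x : MAtom A, AtomGroup x} {x y : MAtom A} {a : A} {u : ℤ}
    (hta : Typed x.1 y.1 a) (h : comp (gpow g x 1) a = comp a (gpow g y u)) (k : ℤ) :
    comp (gpow g x k) a = comp a (gpow g y (u * k)) := by
  induction k using Int.induction_on with
  | zero => rw [mul_zero, gpow_zero, gpow_zero, hta.1, hta.2]
  | succ i ih =>
    rw [← gpow_comp_gpow_comp, h, comp_assoc, ih, comp_gpow_comp_gpow, mul_add, mul_one]
  | pred i ih =>
    have h1 : comp (gpow g x (-1)) a = comp a (gpow g y (-u)) := by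
      have h2 : comp (gpow g x (-1)) (comp (gpow g x 1) a) = a := by
        rw [gpow_comp_gpow_comp, neg_add_cancel, gpow_zero, hta.1]
      rw [h] at h2
      conv_rhs => rw [← h2]
      rw [← comp_assoc, comp_gpow_comp_gpow, add_neg_cancel, gpow_zero, hta.2]
    rw [sub_eq_add_neg, ← gpow_comp_gpow_comp, h1, comp_assoc, ih, comp_gpow_comp_gpow]
    congr 2
    ring

variable (A) in
-- One atom `a` of the rectangle determines `m` and `u`. Every other one is a left translate of `a`
-- by a power of `gen x`; such translations commute with right translations and, the group being
-- cyclic, with each other.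
theorem nonempty_generatorSystem
    (hG : ∀ x : MAtom A, Finite (AtomGroup x) ∧ IsCyclic (AtomGroup x)) :
    Nonempty (GeneratorSystem A) := by
  have hg : ∀ x : MAtom A, ∃ g : AtomGroup x, ∀ f : AtomGroup x, ∃ k : ℤ, f = g ^ k := by
    intro x
    have := (hG x).2
    obtain ⟨g, hg⟩ := IsCyclic.exists_generator (α := AtomGroup x)
    refine ⟨g, fun f => ?_⟩
    obtain ⟨k, hk⟩ := Subgroup.mem_zpowers_iff.mp (hg f)
    exact ⟨k, hk.symm⟩
  choose gen hgen using hg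
  have hpair : ∀ x y : MAtom A, ∃ (m : ℕ) (u : ℤ), ∀ a : A, IsAtom a → Typed x.1 y.1 a →
      ∀ k : ℤ, (comp a (gpow gen y k) = a ↔ (m : ℤ) ∣ k) ∧
        comp (gpow gen x k) a = comp a (gpow gen y (u * k)) := by
    intro x y
    by_cases hE : ∃ a : A, IsAtom a ∧ Typed x.1 y.1 a
    · obtain ⟨a, ha, hta⟩ := hE
      obtain ⟨m, hm⟩ := exists_period gen y a hta.2
      obtain ⟨u, hu⟩ : ∃ u : ℤ, comp (gpow gen x 1) a = comp a (gpow gen y u) := by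
        obtain ⟨f, hf⟩ := exists_eq_comp_right ha ((gen x ^ (1 : ℤ)).isAtom_comp ha hta.1) hta
          ((typed_gpow gen x 1).comp hta)
        obtain ⟨u, rfl⟩ := hgen y f
        exact ⟨u, hf⟩
      refine ⟨m, u, fun b hb htb k => ?_⟩
      obtain ⟨f, rfl⟩ := exists_eq_comp ha hb hta htb
      obtain ⟨i, rfl⟩ := hgen x f
      constructor
      · rw [← hm, ← comp_assoc]
        refine ⟨fun h => ?_, fun h => by rw [h]⟩
        have h1 := congrArg (comp (gpow gen x (-i))) h
        change comp (gpow gen x (-i)) (comp (gpow gen x i) _) =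
          comp (gpow gen x (-i)) (comp (gpow gen x i) _) at h1
        rwa [gpow_comp_gpow_comp, gpow_comp_gpow_comp, neg_add_cancel, gpow_zero, hta.1,
          comp_assoc, hta.1] at h1
      · change comp (gpow gen x k) (comp (gpow gen x i) a) =
          comp (comp (gpow gen x i) a) (gpow gen y (u * k))
        rw [gpow_comp_gpow_comp, add_comm, ← gpow_comp_gpow_comp, gpow_comp_eq hta hu k,
          comp_assoc]
    -- Arbitrary values for a rectangle without atoms, where nothing is required.
    · exact ⟨0, 0, fun a ha hta => absurd ⟨a, ha, hta⟩ hE⟩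
  choose m u hmu using hpair
  exact ⟨⟨gen, hgen, fun x => (hG x).1, m, fun x y a ha hta k => (hmu x y a ha hta k).1, u,
    fun x y a ha hta k => (hmu x y a ha hta k).2⟩⟩

namespace GeneratorSystem

variable (S : GeneratorSystem A) {x y z : MAtom A} {a b c d : A}

theorem isAtom_comp_gpow (ha : IsAtom a) (hta : Typed x.1 y.1 a) (k : ℤ) :
    IsAtom (comp a (gpow S.gen y k)) := (S.gen y ^ k).isAtom_comp_right ha hta.2

theorem exists_eq_comp_gpow (ha : IsAtom a) (hb : IsAtom b) (hta : Typed x.1 y.1 a)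
    (htb : Typed x.1 y.1 b) : ∃ k : ℤ, b = comp a (gpow S.gen y k) := by
  obtain ⟨f, hf⟩ := exists_eq_comp_right ha hb hta htb
  obtain ⟨k, rfl⟩ := S.exists_zpow y f
  exact ⟨k, hf⟩

theorem comp_gpow_eq_iff (ha : IsAtom a) (hta : Typed x.1 y.1 a) (i j : ℤ) :
    comp a (gpow S.gen y i) = comp a (gpow S.gen y j) ↔ (S.m x y : ℤ) ∣ i - j := by
  rw [← S.comp_gpow_eq_self x y a ha hta, sub_eq_add_neg, ← comp_gpow_comp_gpow]
  constructor
  · intro h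
    rw [h, comp_gpow_comp_gpow, add_neg_cancel, gpow_zero, hta.2]
  · intro h
    have h1 := congrArg (fun r => comp r (gpow S.gen y j)) h
    simp only [comp_gpow_comp_gpow] at h1
    rwa [neg_add_cancel_right] at h1

/-- The period of the atom `x` itself, so that `S.m x x` is the order of `G_x`. -/
theorem m_self_dvd (x : MAtom A) (k : ℤ) : gpow S.gen x k = x.1 ↔ (S.m x x : ℤ) ∣ k := by
  have h := S.comp_gpow_eq_self x x x.1 x.2.isAtom (Typed.self x.2.le_ident) k
  rwa [(typed_gpow S.gen x k).1] at h

theorem m_self_ne_zero (x : MAtom A) : S.m x x ≠ 0 := by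
  have := S.finite x
  intro h
  have h1 := (S.m_self_dvd x (Nat.card (AtomGroup x))).mp (by
    rw [gpow, zpow_natCast, pow_card_eq_one']
    rfl)
  rw [h, Nat.cast_zero, zero_dvd_iff] at h1
  exact Nat.card_pos.ne' (Nat.cast_eq_zero.mp h1)

theorem m_dvd (ha : IsAtom a) (hta : Typed x.1 y.1 a) : S.m x y ∣ S.m y y := by
  rw [← Int.natCast_dvd_natCast, ← S.comp_gpow_eq_self x y a ha hta,
    (S.m_self_dvd y _).mpr dvd_rfl, hta.2]

theorem gpow_comp_eq_self (ha : IsAtom a) (hta : Typed x.1 y.1 a) (k : ℤ) :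
    comp (gpow S.gen x k) a = a ↔ (S.m y x : ℤ) ∣ k := by
  rw [← dvd_neg, ← S.comp_gpow_eq_self y x (conv a) (isAtom_conv ha)
    (hta.conv x.2.le_ident y.2.le_ident), ← conv_gpow, ← conv_comp]
  exact ⟨fun h => by rw [h], fun h => by simpa only [conv_conv] using congrArg conv h⟩

/-- Left translation by `gen x ^ k` is right translation by `gen y ^ (u * k)`, hence trivial when `m
x y` divides `k`. Converse gives the other divisibility. -/
theorem m_symm (ha : IsAtom a) (hta : Typed x.1 y.1 a) : S.m y x = S.m x y := by
  have key : ∀ {x y : MAtom A} {a : A}, IsAtom a → Typed x.1 y.1 a → S.m y x ∣ S.m x y := by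
    intro x y a ha hta
    rw [← Int.natCast_dvd_natCast, ← S.gpow_comp_eq_self ha hta, S.gpow_comp x y a ha hta,
      S.comp_gpow_eq_self x y a ha hta]
    exact Dvd.intro_left _ rfl
  exact Nat.dvd_antisymm (key ha hta)
    (key (isAtom_conv ha) (hta.conv x.2.le_ident y.2.le_ident))

/-- `a˘;a` is the sum of the elements of `G_y` that stabilize the atom `a`. -/
theorem exists_le_gpow_comp (ha : IsAtom a) (hta : Typed x.1 y.1 a) (hc : IsAtom c)
    (h : c ≤ comp (conv a) (comp a d)) :
    ∃ k : ℤ, (S.m x y : ℤ) ∣ k ∧ c ≤ comp (gpow S.gen y k) d := by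
  have h1 : ¬ Disjoint (comp (conv a) a) (comp c (conv d)) := by
    rw [← disjoint_comp_right, ← comp_assoc, disjoint_comm]
    exact hc.not_disjoint_of_le h
  obtain ⟨f, hf1, hf2⟩ := exists_atomGroup_le
    ((hta.conv x.2.le_ident y.2.le_ident).comp hta) h1
  obtain ⟨k, rfl⟩ := S.exists_zpow y f
  refine ⟨k, ?_, ?_⟩
  · rw [← S.comp_gpow_eq_self x y a ha hta]
    have h2 := atom_cycle_left ha (S.gen y ^ k).isAtom hf1
    rw [conv_conv] at h2
    exact (ha.eq_of_le (S.isAtom_comp_gpow ha hta k) h2).symm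
  · refine hc.le_of_not_disjoint fun hd => ?_
    rw [disjoint_comm, disjoint_comp_right] at hd
    exact (S.gen y ^ k).isAtom.not_disjoint_of_le hf2 hd

/-- Atoms below `a;b` differ by multiples of the greatest common divisor of the periods. -/
theorem gcd_dvd_of_le_comp (ha : IsAtom a) (hta : Typed x.1 y.1 a) (hb : IsAtom b)
    (htb : Typed y.1 z.1 b) (hc : IsAtom c) (htc : Typed x.1 z.1 c) (h : c ≤ comp a b) {k : ℤ}
    (hk : comp c (gpow S.gen z k) ≤ comp a b) :
    (((S.m x y).gcd (S.m y z) : ℕ) : ℤ) ∣ k := by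
  -- By the cycle law, `b;g_z^(-k)` lies below `conv a;(a;b)`, so it equals `g_y^j;b = b;g_z^(u*j)`
  -- for some `j` divisible by `m x y`. Hence `m y z` divides `-k - u*j`.
  have h1 := atom_cycle_left hb (S.isAtom_comp_gpow hc htc k) hk
  have h2 : comp b (gpow S.gen z (-k)) ≤ comp (conv a) (comp a b) := by
    have h3 := comp_mono_left (gpow S.gen z (-k)) h1
    rw [comp_assoc, comp_gpow_comp_gpow, add_neg_cancel, gpow_zero, ← comp_assoc, htc.2] at h3
    exact h3.trans (comp_mono_right _ h)
  obtain ⟨j, hj, hj'⟩ := S.exists_le_gpow_comp ha hta (S.isAtom_comp_gpow hb htb _) h2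
  rw [S.gpow_comp y z b hb htb] at hj'
  have h4 := (S.comp_gpow_eq_iff hb htb _ _).mp ((S.isAtom_comp_gpow hb htb _).eq_of_le
    (S.isAtom_comp_gpow hb htb _) hj')
  have h5 := (Int.natCast_dvd_natCast.mpr (Nat.gcd_dvd_left (S.m x y) (S.m y z))).trans hj
  have h6 := (Int.natCast_dvd_natCast.mpr (Nat.gcd_dvd_right (S.m x y) (S.m y z))).trans h4
  have h7 := dvd_neg.mpr (dvd_add h6 (h5.mul_left (S.u y z)))
  rwa [show -(-k - S.u y z * j + S.u y z * j) = k by ring] at h7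

/-- `x;1;y` is not zero. -/
def Linked (x y : MAtom A) : Prop := ∃ a : A, IsAtom a ∧ Typed x.1 y.1 a

theorem Linked.refl (x : MAtom A) : Linked x x :=
  ⟨x.1, x.2.isAtom, Typed.self x.2.le_ident⟩

theorem Linked.symm {x y : MAtom A} (h : Linked x y) : Linked y x :=
  h.elim fun a ha => ⟨conv a, isAtom_conv ha.1, ha.2.conv x.2.le_ident y.2.le_ident⟩

theorem exists_atom_le_comp (S : GeneratorSystem A) (ha : IsAtom a)
    (hta : Typed x.1 y.1 a) (hb : IsAtom b) (htb : Typed y.1 z.1 b) :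
    ∃ c, IsAtom c ∧ Typed x.1 z.1 c ∧ c ≤ comp a b := by
  have := S.finite x
  have ht := hta.comp htb
  obtain ⟨c, hc, hca⟩ := exists_atom_le ht (hta.comp_ne_bot y.2.isAtom htb ha.1 hb.1)
  exact ⟨c, hc, ht.mono x.2.le_ident z.2.le_ident hca, hca⟩

theorem Linked.trans (S : GeneratorSystem A) (h : Linked x y) (h' : Linked y z) : Linked x z := by
  obtain ⟨a, ha, hta⟩ := h
  obtain ⟨b, hb, htb⟩ := h'
  obtain ⟨c, hc, htc, -⟩ := S.exists_atom_le_comp ha hta hb htb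
  exact ⟨c, hc, htc⟩

/-- Translation by `gen z ^ m x z` fixes an atom `c` below `a;b`, so `gcd_dvd_of_le_comp` applies
with `k = m x z`. -/
theorem gcd_dvd_m (h : Linked x y) (h' : Linked y z) :
    (S.m x y).gcd (S.m y z) ∣ S.m x z := by
  obtain ⟨a, ha, hta⟩ := h
  obtain ⟨b, hb, htb⟩ := h'
  obtain ⟨c, hc, htc, hcab⟩ := S.exists_atom_le_comp ha hta hb htb
  rw [← Int.natCast_dvd_natCast]
  refine S.gcd_dvd_of_le_comp ha hta hb htb hc htc hcab ?_
  rwa [(S.comp_gpow_eq_self x z c hc htc _).mpr dvd_rfl]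

/-- Moving `gen x` to the right through `c ≤ a;b` gives exponent `u x z`; moving it through `a` and
then `b` gives `u y z * u x y`. The two translates are compared below `a;b`. -/
theorem gcd_dvd_u (h : Linked x y) (h' : Linked y z) :
    (((S.m x y).gcd (S.m y z) : ℕ) : ℤ) ∣ S.u x z - S.u y z * S.u x y := by
  obtain ⟨a, ha, hta⟩ := h
  obtain ⟨b, hb, htb⟩ := h'
  obtain ⟨c, hc, htc, hcab⟩ := S.exists_atom_le_comp ha hta hb htb
  refine S.gcd_dvd_of_le_comp ha hta hb htb hc htc hcab ?_
  have h1 := comp_mono_right (gpow S.gen x 1) hcab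
  rw [comp_assoc, S.gpow_comp x y a ha hta, ← comp_assoc, S.gpow_comp y z b hb htb,
    S.gpow_comp x z c hc htc, comp_assoc] at h1
  have h2 := comp_mono_left (gpow S.gen z (-(S.u y z * S.u x y))) h1
  rw [comp_gpow_comp_gpow, comp_gpow_comp_gpow] at h2
  simpa only [mul_one, add_neg_cancel, gpow_zero, ← comp_assoc, htb.2, sub_eq_add_neg] using h2

theorem m_self_dvd_u_self (x : MAtom A) : (S.m x x : ℤ) ∣ S.u x x - 1 := by
  rw [← S.comp_gpow_eq_iff x.2.isAtom (Typed.self x.2.le_ident)]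
  have h := S.gpow_comp x x x.1 x.2.isAtom (Typed.self x.2.le_ident) 1
  rw [mul_one] at h
  rw [← h, (typed_gpow S.gen x 1).1, (typed_gpow S.gen x 1).2]

/-- Going to `y` and back shows `u y x * u x y ≡ u x x ≡ 1` modulo `m x y`. -/
theorem isCoprime_u (h : Linked x y) : IsCoprime (S.u x y) (S.m x y : ℤ) := by
  obtain ⟨a, ha, hta⟩ := id h
  have h1 := S.gcd_dvd_u h h.symm
  rw [S.m_symm ha hta, Nat.gcd_self] at h1
  have h2 : (S.m x y : ℤ) ∣ S.u x x - 1 := by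
    refine (Int.natCast_dvd_natCast.mpr ?_).trans (S.m_self_dvd_u_self x)
    rw [← S.m_symm ha hta]
    exact S.m_dvd (isAtom_conv ha) (hta.conv x.2.le_ident y.2.le_ident)
  obtain ⟨k, hk⟩ := dvd_sub h1 h2
  exact ⟨S.u y x, k, by linear_combination -hk⟩

end GeneratorSystem

end Generators

/-! ### Coherent generators and the consistent choice of atoms. -/

section Scaffold

variable {A : Type u} [RelationAlgebra A]

namespace GeneratorSystem

/-- These are the exponents for the new generators `gen x ^ v x`: coprimality keeps them generators,
and the congruences make all `u` equal to 1. `v y` is chosen along a well-order, subject to the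
congruences for earlier `x`. -/
theorem exists_coherent_exponents (S : GeneratorSystem A) :
    ∃ v : MAtom A → ℤ, (∀ x, IsCoprime (v x) (S.m x x : ℤ)) ∧
      ∀ x y, Linked x y → (S.m x y : ℤ) ∣ v y - S.u x y * v x := by
  let lt : MAtom A → MAtom A → Prop := WellOrderingRel
  have htr : ∀ {x y z : MAtom A}, lt x y → lt y z → lt x z := fun h h' => _root_.trans h h'
  have htri : ∀ x y : MAtom A, lt x y ∨ x = y ∨ lt y x := trichotomous_of WellOrderingRel
  obtain ⟨v, hv⟩ := exists_forall_of_wellFounded (T := ℤ) (lt := lt)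
    (IsWellFounded.wf (r := (WellOrderingRel : MAtom A → MAtom A → Prop))) htr
    (fun y v => IsCoprime (v y) (S.m y y : ℤ) ∧
      ∀ x, lt x y → Linked x y → (S.m x y : ℤ) ∣ v y - S.u x y * v x) (by
    rintro y f g hfg ⟨h1, h2⟩
    rw [hfg y (Or.inr rfl)] at h1 h2
    refine ⟨h1, fun x hx hxy => ?_⟩
    rw [← hfg x (Or.inl hx)]
    exact h2 x hx hxy) (by
    intro y v ih
    let ι := {x : MAtom A // lt x y ∧ Linked x y}
    have hdvd : ∀ s : ι, S.m s.1 y ∣ S.m y y := fun s =>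
      s.2.2.elim fun a ha => S.m_dvd ha.1 ha.2
    have hcop : ∀ s : ι, IsCoprime (S.u s.1 y * v s.1) (S.m s.1 y : ℤ) := by
      intro s
      refine (S.isCoprime_u s.2.2).mul_left ((ih s.1 s.2.1).1.of_isCoprime_of_dvd_right ?_)
      obtain ⟨a, ha, hta⟩ := s.2.2.symm
      rw [S.m_symm ha hta]
      exact Int.natCast_dvd_natCast.mpr (S.m_dvd ha hta)
    -- For `x` before `z` before `y`: `u x y * v x ≡ u z y * u x z * v x ≡ u z y * v z`. Both
    -- congruences hold modulo the gcd because it divides `m x z`.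
    have hlt : ∀ s t : ι, lt s.1 t.1 → (((S.m s.1 y).gcd (S.m t.1 y) : ℕ) : ℤ) ∣
        S.u s.1 y * v s.1 - S.u t.1 y * v t.1 := by
      rintro ⟨x, hx, hxy⟩ ⟨z, hz, hzy⟩ hxz
      change lt x z at hxz
      change (((S.m x y).gcd (S.m z y) : ℕ) : ℤ) ∣ S.u x y * v x - S.u z y * v z
      have hxz' : Linked x z := hxy.trans S hzy.symm
      obtain ⟨a, ha, hta⟩ := id hzy
      have h1 := S.gcd_dvd_m hxy hzy.symm
      rw [S.m_symm ha hta] at h1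
      have h2 := (Int.natCast_dvd_natCast.mpr h1).trans ((ih z hz).2 x hxz hxz')
      have h3 := (Int.natCast_dvd_natCast.mpr (Nat.dvd_gcd h1 (Nat.gcd_dvd_right _ _))).trans
        (S.gcd_dvd_u hxz' hzy)
      have h4 := dvd_sub (h3.mul_right (v x)) (h2.mul_left (S.u z y))
      exact IndexSystem.dvd_cast h4 (by ring)
    obtain ⟨k, hk, hk'⟩ := exists_coprime_solution_of_dvd (S.m_self_ne_zero y)
      (fun s : ι => S.m s.1 y) hdvd (fun s => S.u s.1 y * v s.1) hcop (by
        intro s t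
        rcases htri s.1 t.1 with h | h | h
        · exact hlt s t h
        · rw [Subtype.ext h, sub_self]
          exact dvd_zero _
        · rw [Nat.gcd_comm, ← dvd_neg, neg_sub]
          exact hlt t s h)
    refine ⟨k, ?_, fun x hx hxy => ?_⟩
    · simpa only [if_true] using hk
    · have hne : x ≠ y := by
        rintro rfl
        exact irrefl_of WellOrderingRel x hx
      simpa only [if_true, if_neg hne] using hk' ⟨x, hx, hxy⟩)
  refine ⟨v, fun x => (hv x).1, fun x y hxy => ?_⟩
  rcases htri x y with h | rfl | h
  · exact (hv y).2 x h hxy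
  · have h1 := (S.m_self_dvd_u_self x).mul_left (-v x)
    exact IndexSystem.dvd_cast h1 (by ring)
  -- With `y` before `x`, the recursion gives `v x ≡ u y x * v y`; multiply by `u x y`, the inverse
  -- of `u y x` modulo `m x y`.
  · obtain ⟨a, ha, hta⟩ := id hxy
    have h1 := (hv x).2 y h hxy.symm
    rw [S.m_symm ha hta] at h1
    have h2 := S.gcd_dvd_u hxy.symm hxy
    rw [S.m_symm ha hta, Nat.gcd_self] at h2
    have h3 := (Int.natCast_dvd_natCast.mpr (S.m_dvd ha hta)).trans (S.m_self_dvd_u_self y)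
    have h4 := dvd_sub ((dvd_sub h2 h3).mul_right (v y)) (h1.mul_left (S.u x y))
    exact IndexSystem.dvd_cast h4 (by ring)

theorem exists_coherent (S : GeneratorSystem A) :
    ∃ S' : GeneratorSystem A, ∀ x y, S'.u x y = 1 := by
  obtain ⟨v, hv, hvu⟩ := S.exists_coherent_exponents
  have hpow : ∀ x k, gpow (fun x => S.gen x ^ v x) x k = gpow S.gen x (v x * k) := by
    intro x k
    simp only [gpow, ← zpow_mul]
  refine ⟨⟨fun x => S.gen x ^ v x, fun x f => ?_, S.finite, S.m, fun x y a ha hta k => ?_,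
    fun _ _ => 1, fun x y a ha hta k => ?_⟩, fun _ _ => rfl⟩
  · obtain ⟨k, rfl⟩ := S.exists_zpow x f
    obtain ⟨i, j, hij⟩ := hv x
    refine ⟨i * k, Subtype.ext ?_⟩
    change gpow S.gen x k = gpow (fun x => S.gen x ^ v x) x (i * k)
    have h := (S.comp_gpow_eq_iff x.2.isAtom (Typed.self x.2.le_ident) k (v x * (i * k))).mpr
      ⟨j * k, by linear_combination (-k) * hij⟩
    rwa [(typed_gpow S.gen x _).1, (typed_gpow S.gen x _).1, ← hpow] at h
  · rw [hpow, S.comp_gpow_eq_self x y a ha hta]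
    have h := ((hv y).of_isCoprime_of_dvd_right
      (Int.natCast_dvd_natCast.mpr (S.m_dvd ha hta))).symm
    exact ⟨h.dvd_of_dvd_mul_left, fun h' => h'.mul_left _⟩
  · rw [hpow, hpow, S.gpow_comp x y a ha hta, S.comp_gpow_eq_iff ha hta]
    have h := dvd_neg.mpr ((hvu x y ⟨a, ha, hta⟩).mul_right k)
    exact IndexSystem.dvd_cast h (by ring)

variable (S : GeneratorSystem A) {x y z : MAtom A} {a b : A}

/-- By Bézout, `k` is a multiple of `m x y` plus a multiple of `m y z`. The first part passes
through `b` unchanged and is absorbed by `a`; the second is absorbed by `b`. -/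
theorem comp_comp_gpow_of_gcd_dvd (hu : ∀ x y, S.u x y = 1) (ha : IsAtom a)
    (hta : Typed x.1 y.1 a) (hb : IsAtom b) (htb : Typed y.1 z.1 b) {k : ℤ}
    (hk : (((S.m x y).gcd (S.m y z) : ℕ) : ℤ) ∣ k) :
    comp (comp a b) (gpow S.gen z k) = comp a b := by
  obtain ⟨c, rfl⟩ := hk
  rw [Nat.gcd_eq_gcd_ab, add_mul, gpow_add, comp_assoc, mul_assoc, mul_assoc]
  have h1 := S.gpow_comp y z b hb htb ((S.m x y : ℤ) * ((S.m x y).gcdA (S.m y z) * c))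
  rw [hu, one_mul] at h1
  rw [← comp_assoc a b, ← h1, comp_assoc, (S.comp_gpow_eq_self x y a ha hta _).mpr
    (dvd_mul_right _ _), ← comp_assoc, (S.comp_gpow_eq_self y z b hb htb _).mpr
    (dvd_mul_right _ _)]

/-- If `p`, `q` are atoms with the same domain, then `p˘;q` contains, up to a power of a
generator, every composition `r˘;s` for which `r ≤ t;p` and `s ≤ t;q`. -/
theorem exists_comp_gpow_le (hu : ∀ x y, S.u x y = 1) {w : MAtom A} {p q r s t : A}
    (htp : Typed z.1 x.1 p) (hq : IsAtom q) (htq : Typed z.1 y.1 q)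
    (ht : IsAtom t) (htt : Typed w.1 z.1 t) (hr : r ≤ comp t p) (hs : s ≤ comp t q)
    (hb : IsAtom b) (htb : Typed x.1 y.1 b) (h : b ≤ comp (conv r) s) :
    ∃ j : ℤ, (S.m w z : ℤ) ∣ j ∧ comp b (gpow S.gen y (-j)) ≤ comp (conv p) q := by
  have := S.finite z
  have h1 : b ≤ comp (conv p) (comp (conv t) (comp t q)) := by
    refine h.trans ((comp_mono (conv_mono hr) hs).trans ?_)
    rw [conv_comp, ← comp_assoc]
  -- An atom `e` of this meet lies below `gen z ^ j;q` with `m w z` dividing `j`. From `e ≤ p;b` it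
  -- follows that `b ≤ conv p;e`, which is below `conv p;q;gen y ^ j`.
  have h2 : comp (conv t) (comp t q) ⊓ comp p b ≠ ⊥ := by
    rw [Ne, ← disjoint_iff]
    intro hd
    have h3 := disjoint_comp_left (a := conv p) (b := comp (conv t) (comp t q)) (c := b)
    rw [conv_conv] at h3
    exact hb.not_disjoint_of_le h1 (h3.mpr hd).symm
  have h3 : Typed z.1 y.1 (comp (conv t) (comp t q) ⊓ comp p b) :=
    (htp.comp htb).mono z.2.le_ident y.2.le_ident inf_le_right
  obtain ⟨e, he, hle⟩ := exists_atom_le h3 h2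
  obtain ⟨j, hj, hj'⟩ := S.exists_le_gpow_comp ht htt he (hle.trans inf_le_left)
  refine ⟨j, hj, ?_⟩
  have h4 := atom_cycle_left hb he (hle.trans inf_le_right)
  have h5 := comp_mono_left (gpow S.gen y (-j)) (h4.trans (comp_mono_right _ hj'))
  rw [S.gpow_comp z y q hq htq, hu, one_mul, ← comp_assoc, comp_gpow_comp_gpow,
    add_neg_cancel, gpow_zero, htq.2] at h5
  exact h5

/-- `α x y` is a fixed atom translated by `gen y ^ k`. For each `z` before `x`, the triangle `z, x,
y` holds once `k` satisfies a congruence modulo `gcd (m z x) (m z y)`. These congruences are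
pairwise compatible by the triangles chosen earlier. -/
theorem exists_ordered_scaffold (hu : ∀ x y, S.u x y = 1) :
    ∃ α : MAtom A → MAtom A → A,
      (∀ x y, Linked x y → IsAtom (α x y) ∧ Typed x.1 y.1 (α x y)) ∧
      ∀ x y z, WellOrderingRel x y → WellOrderingRel y z → Linked x y → Linked y z →
        α x z ≤ comp (α x y) (α y z) := by
  let lt : MAtom A → MAtom A → Prop := WellOrderingRel
  have htr : ∀ {x y z : MAtom A}, lt x y → lt y z → lt x z := fun h h' => _root_.trans h h'
  have htri : ∀ x y : MAtom A, lt x y ∨ x = y ∨ lt y x := trichotomous_of WellOrderingRel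
  have hirr : ∀ x : MAtom A, ¬ lt x x := irrefl_of WellOrderingRel
  have hwf : WellFounded lt :=
    IsWellFounded.wf (r := (WellOrderingRel : MAtom A → MAtom A → Prop))
  choose! α₀ hα₀ hα₀t using fun (x y : MAtom A) (h : Linked x y) => h
  -- The exponent is stored at `(y, x)`, later atom first, so that in the lexicographic order `α z
  -- x` and `α z y` precede `α x y` when `z` precedes `x` and `x` precedes `y`.
  let α : (MAtom A × MAtom A → ℤ) → MAtom A → MAtom A → A := fun f x y =>
    comp (α₀ x y) (gpow S.gen y (f (y, x)))
  have hα : ∀ f x y, Linked x y → IsAtom (α f x y) := fun f x y h =>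
    S.isAtom_comp_gpow (hα₀ x y h) (hα₀t x y h) _
  have hαt : ∀ f x y, Linked x y → Typed x.1 y.1 (α f x y) := fun f x y h =>
    (hα₀t x y h).comp (typed_gpow S.gen y _)
  have hαc : ∀ f g x y, f (y, x) = g (y, x) → α f x y = α g x y := fun f g x y h => by
    simp only [α, h]
  obtain ⟨f, hf⟩ := exists_forall_of_wellFounded (T := ℤ) (lt := Prod.Lex lt lt)
    (WellFounded.prod_lex hwf hwf) (fun {p q r} h h' => by
      rw [Prod.lex_def] at h h' ⊢
      rcases h with h | ⟨h1, h2⟩ <;> rcases h' with h' | ⟨h1', h2'⟩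
      · exact Or.inl (htr h h')
      · exact Or.inl (h1' ▸ h)
      · exact Or.inl (h1 ▸ h')
      · exact Or.inr ⟨h1.trans h1', htr h2 h2'⟩)
    (fun p f => lt p.2 p.1 → Linked p.2 p.1 → ∀ z, lt z p.2 → Linked z p.2 →
      α f z p.1 ≤ comp (α f z p.2) (α f p.2 p.1)) (by
    rintro ⟨y, x⟩ f g hfg h hxy hl z hz hzl
    have h1 := h hxy hl z hz hzl
    rwa [hαc f g z y (hfg _ (Or.inl (Prod.Lex.right y hz))),
      hαc f g z x (hfg _ (Or.inl (Prod.Lex.left _ _ hxy))),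
      hαc f g x y (hfg _ (Or.inr rfl))] at h1) (by
    rintro ⟨y, x⟩ f ih
    by_cases hxy : lt x y ∧ Linked x y
    swap
    · exact ⟨0, fun h h' => absurd ⟨h, h'⟩ hxy⟩
    obtain ⟨hxy, hl⟩ := hxy
    let ι := {z : MAtom A // lt z x ∧ Linked z x}
    have hly : ∀ s : ι, Linked s.1 y := fun s => s.2.2.trans S hl
    have hr : ∀ s : ι, ∃ r : ℤ, comp (α₀ x y) (gpow S.gen y r) ≤
        comp (conv (α f s.1 x)) (α f s.1 y) := by
      intro s
      obtain ⟨c, hc, htc, hle⟩ := S.exists_atom_le_comp (isAtom_conv (hα f s.1 x s.2.2))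
        ((hαt f s.1 x s.2.2).conv s.1.2.le_ident x.2.le_ident) (hα f s.1 y (hly s))
        (hαt f s.1 y (hly s))
      obtain ⟨r, rfl⟩ := S.exists_eq_comp_gpow (hα₀ x y hl) hc (hα₀t x y hl) htc
      exact ⟨r, hle⟩
    choose r hr using hr
    have hm : ∀ s : ι, S.m x s.1 = S.m s.1 x := fun s =>
      S.m_symm (hα f s.1 x s.2.2) (hαt f s.1 x s.2.2)
    have hlt : ∀ s t : ι, lt s.1 t.1 →
        ((((S.m s.1 x).gcd (S.m s.1 y)).gcd ((S.m t.1 x).gcd (S.m t.1 y)) : ℕ) : ℤ) ∣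
          r s - r t := by
      intro s t hst
      have hst' : Linked s.1 t.1 := s.2.2.trans S t.2.2.symm
      -- The triangles `s, t, x` and `s, t, y` carry the solution `r s` over to `t`, up to `j`, a
      -- multiple of `m s t`. Below the composition for `t`, this solution and `r t` differ by a
      -- multiple of the gcd for `t`.
      obtain ⟨j, hj, hle⟩ := S.exists_comp_gpow_le hu (hαt f t.1 x t.2.2) (hα f t.1 y (hly t))
        (hαt f t.1 y (hly t)) (hα f s.1 t.1 hst') (hαt f s.1 t.1 hst')
        (ih (x, t.1) (Prod.Lex.left _ _ hxy) t.2.1 t.2.2 s.1 hst hst')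
        (ih (y, t.1) (Prod.Lex.right _ t.2.1) (htr t.2.1 hxy) (hly t) s.1 hst hst')
        (S.isAtom_comp_gpow (hα₀ x y hl) (hα₀t x y hl) (r s))
        ((hα₀t x y hl).comp (typed_gpow S.gen y _)) (hr s)
      rw [comp_gpow_comp_gpow, show r s + -j = r t + (r s - j - r t) by ring,
        ← comp_gpow_comp_gpow] at hle
      have h1 := S.gcd_dvd_of_le_comp (isAtom_conv (hα f t.1 x t.2.2))
        ((hαt f t.1 x t.2.2).conv t.1.2.le_ident x.2.le_ident) (hα f t.1 y (hly t))
        (hαt f t.1 y (hly t)) (S.isAtom_comp_gpow (hα₀ x y hl) (hα₀t x y hl) (r t))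
        ((hα₀t x y hl).comp (typed_gpow S.gen y _)) (hr t) hle
      rw [hm t] at h1
      have h2 := S.gcd_dvd_m s.2.2 t.2.2.symm
      rw [hm t] at h2
      have h3 : ((S.m s.1 x).gcd (S.m s.1 y)).gcd ((S.m t.1 x).gcd (S.m t.1 y)) ∣
          S.m s.1 t.1 :=
        (Nat.gcd_dvd_gcd_of_dvd_left _ (Nat.gcd_dvd_left _ _)).trans
          ((Nat.gcd_dvd_gcd_of_dvd_right _ (Nat.gcd_dvd_left _ _)).trans h2)
      have h4 := dvd_add ((Int.natCast_dvd_natCast.mpr (Nat.gcd_dvd_right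
        ((S.m s.1 x).gcd (S.m s.1 y)) _)).trans h1) ((Int.natCast_dvd_natCast.mpr h3).trans hj)
      exact IndexSystem.dvd_cast h4 (by ring)
    have hdvd : ∀ s : ι, (S.m s.1 x).gcd (S.m s.1 y) ∣ S.m x y := by
      intro s
      rw [← hm s]
      exact S.gcd_dvd_m s.2.2.symm (hly s)
    have hxy0 : S.m x y ≠ 0 := ne_zero_of_dvd_ne_zero (S.m_self_ne_zero y)
      (S.m_dvd (hα₀ x y hl) (hα₀t x y hl))
    obtain ⟨k, hk⟩ := exists_solution_of_dvd hxy0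
      (fun s : ι => (S.m s.1 x).gcd (S.m s.1 y)) hdvd r (by
        intro s t
        rcases htri s.1 t.1 with h | h | h
        · exact hlt s t h
        · rw [Subtype.ext h, sub_self]
          exact dvd_zero _
        · rw [Nat.gcd_comm, ← dvd_neg, neg_sub]
          exact hlt t s h)
    refine ⟨k, fun _ _ z hz hzl => ?_⟩
    have e1 : ((y, z) : MAtom A × MAtom A) ≠ (y, x) := fun h => by
      cases h
      exact hirr _ hz
    have e2 : ((x, z) : MAtom A × MAtom A) ≠ (y, x) := fun h => by
      cases h
      exact hirr _ hxy
    simp only [α, if_neg e1, if_neg e2, if_true]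
    change α f z y ≤ comp (α f z x) (comp (α₀ x y) (gpow S.gen y k))
    let s : ι := ⟨z, hz, hzl⟩
    have h1 := atom_cycle_left (hα f z y (hly s))
      (S.isAtom_comp_gpow (hα₀ x y hl) (hα₀t x y hl) (r s)) (hr s)
    rw [conv_conv] at h1
    refine h1.trans (le_of_eq ?_)
    -- Replacing `r s` by `k` leaves `α z x;α x y` unchanged, since `gcd (m z x) (m x y)` also
    -- divides `m z y`.
    have h2 : (((S.m z x).gcd (S.m x y) : ℕ) : ℤ) ∣ k - r s := by
      refine (Int.natCast_dvd_natCast.mpr (Nat.dvd_gcd (Nat.gcd_dvd_left _ _) ?_)).trans (hk s)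
      exact S.gcd_dvd_m hzl hl
    have h3 := S.comp_comp_gpow_of_gcd_dvd hu (hα f z x hzl) (hαt f z x hzl)
      (S.isAtom_comp_gpow (hα₀ x y hl) (hα₀t x y hl) (r s))
      ((hα₀t x y hl).comp (typed_gpow S.gen y _)) h2
    rw [← h3, ← comp_assoc, comp_gpow_comp_gpow, add_sub_cancel])
  exact ⟨α f, fun x y h => ⟨hα f x y h, hαt f x y h⟩, fun x y z hxy hyz hl hl' =>
    hf (z, y) hyz hl' x hxy hl⟩

/-- A scaffold: a system of atoms `α x y` below `x;1;y` that is a consistent atomic network. -/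
structure IsScaffold (α : MAtom A → MAtom A → A) : Prop where
  isAtom : ∀ {x y}, Linked x y → IsAtom (α x y)
  typed : ∀ {x y}, Linked x y → Typed x.1 y.1 (α x y)
  self : ∀ x, α x x = x.1
  conv : ∀ {x y}, Linked x y → conv (α x y) = α y x
  le_comp : ∀ {x y z}, Linked x y → Linked y z → α x z ≤ comp (α x y) (α y z)

theorem exists_scaffold (hu : ∀ x y, S.u x y = 1) :
    ∃ α : MAtom A → MAtom A → A, IsScaffold α := by
  classical
  obtain ⟨β, hβ, hβle⟩ := S.exists_ordered_scaffold hu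
  let lt : MAtom A → MAtom A → Prop := WellOrderingRel
  have htri : ∀ x y : MAtom A, lt x y ∨ x = y ∨ lt y x := trichotomous_of WellOrderingRel
  have hirr : ∀ x : MAtom A, ¬ lt x x := irrefl_of WellOrderingRel
  have hasy : ∀ {x y : MAtom A}, lt x y → ¬ lt y x := fun h h' => asymm_of WellOrderingRel h h'
  have htr : ∀ {x y z : MAtom A}, lt x y → lt y z → lt x z := fun h h' => _root_.trans h h'
  let α : MAtom A → MAtom A → A := fun x y =>
    if lt x y then β x y else if x = y then x.1 else conv (β y x)
  have e1 : ∀ {x y}, lt x y → α x y = β x y := fun h => if_pos h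
  have e2 : ∀ x, α x x = x.1 := fun x => by simp only [α, if_neg (hirr x), if_true]
  have e3 : ∀ {x y}, lt y x → α x y = conv (β y x) := fun {x y} h => by
    have hne : x ≠ y := fun h' => hirr x (by rwa [← h'] at h)
    simp only [α, if_neg (hasy h), if_neg hne]
  have hat : ∀ {x y}, Linked x y → IsAtom (α x y) ∧ Typed x.1 y.1 (α x y) := by
    intro x y hl
    rcases htri x y with h | rfl | h
    · rw [e1 h]
      exact hβ x y hl
    · rw [e2]
      exact ⟨x.2.isAtom, Typed.self x.2.le_ident⟩
    · rw [e3 h]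
      have := hβ y x hl.symm
      exact ⟨isAtom_conv this.1, this.2.conv y.2.le_ident x.2.le_ident⟩
  have hconv : ∀ x y, RelationAlgebra.conv (α x y) = α y x := by
    intro x y
    rcases htri x y with h | rfl | h
    · rw [e1 h, e3 h]
    · rw [e2, conv_eq_self x.2.le_ident]
    · rw [e1 h, e3 h, conv_conv]
  -- `T1` reverses a triangle and `T2` swaps its first two vertices; together they give all
  -- permutations, so ordered and degenerate triangles suffice.
  let T : MAtom A → MAtom A → MAtom A → Prop := fun x y z =>
    Linked x y → Linked y z → α x z ≤ comp (α x y) (α y z)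
  have T0 : ∀ {x y z}, lt x y → lt y z → T x y z := by
    intro x y z h h' hl hl'
    rw [e1 h, e1 h', e1 (htr h h')]
    exact hβle x y z h h' hl hl'
  have T1 : ∀ {x y z}, T x y z → T z y x := by
    intro x y z h hl hl'
    rw [← hconv x z, ← hconv x y, ← hconv y z, ← conv_comp, conv_le_conv]
    exact h hl'.symm hl.symm
  have T2 : ∀ {x y z}, T x y z → T y x z := by
    intro x y z h hl hl'
    have hyz := hl.trans S hl'
    rw [← hconv x y]
    exact atom_cycle_left (hat hyz).1 (hat hl').1 (h hl.symm hyz)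
  have T3 : ∀ {x z}, T x x z := by
    intro x z _ hl
    rw [e2, (hat hl).2.1]
  refine ⟨α, fun hl => (hat hl).1, fun hl => (hat hl).2, e2, fun {x y} _ => hconv x y,
    fun {x y z} => ?_⟩
  change T x y z
  rcases htri x y with h | rfl | h
  · rcases htri y z with h' | rfl | h'
    · exact T0 h h'
    · exact T1 T3
    · rcases htri x z with h'' | rfl | h''
      · exact T1 (T2 (T1 (T0 h'' h')))
      · exact T2 (T1 T3)
      · exact T2 (T1 (T0 h'' h))
  · exact T3
  · rcases htri x z with h' | rfl | h'
    · exact T2 (T0 h h')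
    · exact T2 (T1 T3)
    · rcases htri y z with h'' | rfl | h''
      · exact T1 (T2 (T0 h'' h'))
      · exact T1 T3
      · exact T1 (T0 h'' h)

end GeneratorSystem

end Scaffold

/-! ### Representation in the cyclic group relation algebra. -/

section Representation

variable {A : Type u} [RelationAlgebra A]

/-- If `b` annihilated every measurable atom, all of them, hence also their supremum `ident`, would
lie below the complement of `conv b;⊤`, forcing `b = b;ident = ⊥`. -/
theorem exists_comp_ne_bot (hA : IsMeasurable A) {b : A} (hb : b ≠ ⊥) :
    ∃ y : MAtom A, comp b y.1 ≠ ⊥ := by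
  by_contra! h
  have h1 : (ident : A) ≤ (comp (conv b) ⊤)ᶜ := by
    refine hA.2 fun y hy => ?_
    rw [le_compl_iff_disjoint_right, ← disjoint_comp_left, disjoint_top]
    exact h ⟨y, hy⟩
  rw [le_compl_iff_disjoint_right, ← disjoint_comp_left, comp_ident, disjoint_top] at h1
  exact hb h1

theorem typed_left_unique {x x' y y' a : A} (hx : IsAtom x) (hx' : IsAtom x')
    (hxi : x ≤ ident) (hxi' : x' ≤ ident) (h : Typed x y a) (h' : Typed x' y' a) (ha : a ≠ ⊥) :
    x = x' := by
  have h1 : comp x x' ≠ ⊥ := fun h0 => ha (by rw [← h.1, ← h'.1, comp_assoc, h0, bot_comp])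
  have h2 : comp x x' ≤ x := (comp_mono_right _ hxi').trans (comp_ident _).le
  have h3 : comp x x' ≤ x' := (comp_mono_left _ hxi).trans (ident_comp _).le
  exact ((hx.le_iff.mp h2).resolve_left h1).symm.trans ((hx'.le_iff.mp h3).resolve_left h1)

namespace GeneratorSystem

variable (S : GeneratorSystem A)

/-- In a measurable relation algebra with finite groups, every nonzero element is above an atom
of some rectangle with measurable sides. -/
theorem exists_typed_atom_le (hA : IsMeasurable A) (S : GeneratorSystem A) {b : A}
    (hb : b ≠ ⊥) : ∃ (x y : MAtom A) (a : A), IsAtom a ∧ Typed x.1 y.1 a ∧ a ≤ b := by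
  obtain ⟨y, hy⟩ := exists_comp_ne_bot hA hb
  obtain ⟨x, hx⟩ := exists_comp_ne_bot hA (conv_ne_bot hy)
  have hx' := conv_ne_bot hx
  rw [conv_comp, conv_conv, conv_eq_self x.2.le_ident] at hx'
  have ht : Typed x.1 y.1 (comp x.1 (comp b y.1)) :=
    ⟨by rw [comp_assoc, comp_self x.2.le_ident],
      by rw [← comp_assoc, ← comp_assoc, comp_self y.2.le_ident]⟩
  have := S.finite x
  obtain ⟨a, ha, hle⟩ := exists_atom_le ht hx'
  refine ⟨x, y, a, ha, ht.mono x.2.le_ident y.2.le_ident hle, hle.trans ?_⟩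
  calc comp x.1 (comp b y.1) ≤ comp ident (comp b ident) :=
        comp_mono x.2.le_ident (comp_mono_right _ y.2.le_ident)
    _ = b := by rw [comp_ident, ident_comp]

/-- The index system of a system of generators. -/
def indexSystem : IndexSystem (MAtom A) where
  E := ⟨Linked, Linked.refl, Linked.symm, fun h h' => h.trans S h'⟩
  n x := S.m x x
  n_pos x := Nat.pos_of_ne_zero (S.m_self_ne_zero x)
  m := S.m
  m_pos x y h := h.elim fun _ ha =>
    Nat.pos_of_ne_zero (ne_zero_of_dvd_ne_zero (S.m_self_ne_zero y) (S.m_dvd ha.1 ha.2))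
  dvd_left x y h := by
    obtain ⟨a, ha, hta⟩ := Linked.symm h
    rw [S.m_symm ha hta]
    exact S.m_dvd ha hta
  dvd_right x y h := h.elim fun _ ha => S.m_dvd ha.1 ha.2
  m_self _ := rfl
  m_symm x y h := h.elim fun _ ha => S.m_symm ha.1 ha.2
  gcd_left x y z h h' := by
    refine Nat.dvd_antisymm (Nat.dvd_gcd (Nat.gcd_dvd_left _ _) (S.gcd_dvd_m h h'))
      (Nat.dvd_gcd (Nat.gcd_dvd_left _ _) ?_)
    obtain ⟨a, ha, hta⟩ := Linked.symm h
    rw [S.m_symm ha hta]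
    exact S.gcd_dvd_m (Linked.symm h) (Linked.trans S h h')
  gcd_right x y z h h' := by
    obtain ⟨a, ha, hta⟩ := Linked.symm h
    obtain ⟨b, hb, htb⟩ := Linked.symm h'
    refine Nat.dvd_antisymm (Nat.dvd_gcd (Nat.gcd_dvd_right _ _) ?_)
      (Nat.dvd_gcd ?_ (Nat.gcd_dvd_left _ _))
    · rw [S.m_symm ha hta]
      exact S.gcd_dvd_m (Linked.symm h) (Linked.trans S h h')
    · rw [S.m_symm hb htb]
      exact S.gcd_dvd_m (Linked.trans S h h') (Linked.symm h')

variable {S} (α : MAtom A → MAtom A → A)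

/-- The atom that labels the pair of the `i`th point over `x` and the `i + k`th point over
`y`. -/
def label (S : GeneratorSystem A) (x y : MAtom A) (k : ℤ) : A := comp (α x y) (gpow S.gen y k)

variable {α} {x y z : MAtom A}

theorem isAtom_label (hα : IsScaffold α) (h : Linked x y) (k : ℤ) : IsAtom (label α S x y k) :=
  S.isAtom_comp_gpow (hα.isAtom h) (hα.typed h) k

theorem typed_label (hα : IsScaffold α) (h : Linked x y) (k : ℤ) :
    Typed x.1 y.1 (label α S x y k) :=
  (hα.typed h).comp (typed_gpow S.gen y k)

theorem label_eq_iff (hα : IsScaffold α) (h : Linked x y) (i j : ℤ) :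
    label α S x y i = label α S x y j ↔ (S.m x y : ℤ) ∣ i - j :=
  S.comp_gpow_eq_iff (hα.isAtom h) (hα.typed h) i j

theorem exists_eq_label (hα : IsScaffold α) {a : A} (ha : IsAtom a) (hta : Typed x.1 y.1 a) :
    ∃ k, a = label α S x y k :=
  S.exists_eq_comp_gpow (hα.isAtom ⟨a, ha, hta⟩) ha (hα.typed ⟨a, ha, hta⟩) hta

theorem conv_label (hu : ∀ x y, S.u x y = 1) (hα : IsScaffold α) (h : Linked x y) (k : ℤ) :
    conv (label α S x y k) = label α S y x (-k) := by
  rw [label, label, conv_comp, conv_gpow, hα.conv h,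
    S.gpow_comp y x _ (hα.isAtom h.symm) (hα.typed h.symm), hu, one_mul]

/-- The scaffold triangle translated by `gen z ^ (k + l)`; as `u = 1`, the factor `gen z ^ k`
crosses `α y z` as `gen y ^ k`. -/
theorem label_add_le_comp (hu : ∀ x y, S.u x y = 1) (hα : IsScaffold α) (h : Linked x y)
    (h' : Linked y z) (k l : ℤ) :
    label α S x z (k + l) ≤ comp (label α S x y k) (label α S y z l) := by
  have h1 := comp_mono_left (gpow S.gen z (k + l)) (hα.le_comp h h')
  refine h1.trans (le_of_eq ?_)
  have h2 := S.gpow_comp y z _ (hα.isAtom h') (hα.typed h') k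
  rw [hu, one_mul] at h2
  rw [label, label, ← comp_assoc (α x y) (gpow S.gen y k), comp_assoc (gpow S.gen y k), h2,
    comp_gpow_comp_gpow, comp_assoc]

theorem label_self (hα : IsScaffold α) (k : ℤ) : label α S x x k = gpow S.gen x k := by
  rw [label, hα.self, (typed_gpow S.gen x k).1]

theorem label_le_ident_iff (hα : IsScaffold α) (h : Linked x y) (k : ℤ) :
    label α S x y k ≤ ident ↔ x = y ∧ (S.m x y : ℤ) ∣ k := by
  have ht := typed_label (S := S) hα h k
  have ha := isAtom_label (S := S) hα h k
  constructor
  · intro hle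
    have hx : label α S x y k = x.1 := by
      refine ha.eq_of_le x.2.isAtom ?_
      rw [← ht.1]
      exact (comp_mono_right _ hle).trans (comp_ident _).le
    have hy : label α S x y k = y.1 := by
      refine ha.eq_of_le y.2.isAtom ?_
      rw [← ht.2]
      exact (comp_mono_left _ hle).trans (ident_comp _).le
    obtain rfl : x = y := Subtype.ext (hx.symm.trans hy)
    rw [label_self hα, S.m_self_dvd] at hx
    exact ⟨rfl, hx⟩
  · rintro ⟨rfl, hk⟩
    rw [label_self hα, (S.m_self_dvd x k).mpr hk]
    exact x.2.le_ident

/-- Supplies the intermediate point when composition is shown to be preserved. -/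
theorem exists_label_le_of_le_comp (hA : IsMeasurable A) (hu : ∀ x y, S.u x y = 1)
    (hα : IsScaffold α) (h : Linked x z) {k : ℤ} {s t : A}
    (hle : label α S x z k ≤ comp s t) :
    ∃ y, Linked x y ∧ Linked y z ∧
      ∃ l, label α S x y l ≤ s ∧ label α S y z (k - l) ≤ t := by
  have hL := isAtom_label (S := S) hα h k
  have htL := typed_label (S := S) hα h k
  set L := label α S x z k with hLdef
  have h1 : s ⊓ comp L (conv t) ≠ ⊥ := by
    rw [Ne, ← disjoint_iff, ← disjoint_comp_right, disjoint_comm]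
    exact hL.not_disjoint_of_le hle
  obtain ⟨y, hy⟩ := exists_comp_ne_bot hA h1
  have hwle : comp (s ⊓ comp L (conv t)) y.1 ≤ s ⊓ comp L (conv t) :=
    (comp_mono_right _ y.2.le_ident).trans (comp_ident _).le
  have htw : Typed x.1 y.1 (comp (s ⊓ comp L (conv t)) y.1) := by
    refine ⟨comp_eq_of_le_left x.2.le_ident ?_ (hwle.trans inf_le_right), ?_⟩
    · rw [comp_assoc, htL.1]
    · rw [← comp_assoc, comp_self y.2.le_ident]
  have := S.finite x
  have := S.finite y
  obtain ⟨b, hb, hbw⟩ := exists_atom_le htw hy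
  have htb := htw.mono x.2.le_ident y.2.le_ident hbw
  have hbs := (hbw.trans hwle).trans inf_le_left
  have hbL := (hbw.trans hwle).trans inf_le_right
  have hxy : Linked x y := ⟨b, hb, htb⟩
  have hyz : Linked y z := hxy.symm.trans S h
  have h2 : t ⊓ comp (conv b) L ≠ ⊥ := by
    rw [Ne, ← disjoint_iff, ← disjoint_comp_left, disjoint_comp_right]
    exact hb.not_disjoint_of_le hbL
  have htt : Typed y.1 z.1 (t ⊓ comp (conv b) L) :=
    ((htb.conv x.2.le_ident y.2.le_ident).comp htL).mono y.2.le_ident z.2.le_ident inf_le_right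
  obtain ⟨c, hc, hct⟩ := exists_atom_le htt h2
  have htc := htt.mono y.2.le_ident z.2.le_ident hct
  obtain ⟨l, rfl⟩ := exists_eq_label (S := S) hα hb htb
  have h3 : L ≤ comp (label α S x y l) (label α S y z (k - l)) := by
    have := label_add_le_comp (S := S) hu hα hxy hyz l (k - l)
    rwa [add_sub_cancel] at this
  obtain ⟨j, hj, hj'⟩ := S.exists_le_gpow_comp hb htb hc
    ((hct.trans inf_le_right).trans (comp_mono_right _ h3))
  have hyzl := isAtom_label (S := S) hα hyz (k - l)
  have htyzl := typed_label (S := S) hα hyz (k - l)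
  rw [S.gpow_comp y z _ hyzl htyzl, hu, one_mul, label, comp_gpow_comp_gpow] at hj'
  have hc' := hc.eq_of_le (isAtom_label (S := S) hα hyz (k - l + j)) hj'
  -- The atom found below `t` has index `k - l + j` with `m x y` dividing `j`, so passing from `l`
  -- to `l - j` fits it without altering the label below `s`.
  refine ⟨y, hxy, hyz, l - j, ?_, ?_⟩
  · rw [(label_eq_iff (S := S) hα hxy (l - j) l).mpr (by simpa using hj)]
    exact hbs
  · rw [show k - (l - j) = k - l + j by ring, ← hc']
    exact hct.trans inf_le_left

/-- The relation that represents an element of the algebra. -/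
def represent (S : GeneratorSystem A) (α : MAtom A → MAtom A → A) (r : A) :
    SetRel S.indexSystem.Base S.indexSystem.Base :=
  {p | Linked p.1.1 p.2.1 ∧ label α S p.1.1 p.2.1 ((p.2.2.cast : ℤ) - (p.1.2.cast : ℤ)) ≤ r}

theorem mem_represent (hα : IsScaffold α) (r : A) (x y : MAtom A) (i j : ℤ) :
    (((⟨x, (i : S.indexSystem.G x)⟩, ⟨y, (j : S.indexSystem.G y)⟩) :
      S.indexSystem.Base × S.indexSystem.Base) ∈ represent S α r) ↔
      Linked x y ∧ label α S x y (j - i) ≤ r := by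
  refine and_congr_right fun h => ?_
  change label α S x y (((j : ZMod (S.m y y)).cast : ℤ) - ((i : ZMod (S.m x x)).cast : ℤ)) ≤ r ↔ _
  have hd : ∀ (n : ℕ) (i : ℤ), (n : ℤ) ∣ ((i : ZMod n).cast : ℤ) - i := by
    intro n i
    rw [← ZMod.intCast_eq_intCast_iff_dvd_sub, ZMod.intCast_cast, ZMod.cast_id]
  have h1 := (Int.natCast_dvd_natCast.mpr (S.indexSystem.dvd_right x y h)).trans
    (hd (S.m y y) j)
  have h2 := (Int.natCast_dvd_natCast.mpr (S.indexSystem.dvd_left x y h)).trans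
    (hd (S.m x x) i)
  rw [(label_eq_iff (S := S) hα h _ (j - i)).mpr]
  exact IndexSystem.dvd_cast (dvd_sub h1 h2) (by ring)

theorem represent_mem (hα : IsScaffold α) (r : A) :
    represent S α r ∈ S.indexSystem.algebra.carrier := by
  refine (S.indexSystem.mem_carrier_iff _).mpr fun x y i j h => ?_
  rw [mem_represent hα] at h
  refine ⟨h.1, fun i' j' hd => ?_⟩
  rw [mem_represent hα, (label_eq_iff (S := S) hα h.1 _ (j - i)).mpr hd]
  exact h

theorem ext_points {R T : SetRel S.indexSystem.Base S.indexSystem.Base}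
    (h : ∀ (x y : MAtom A) (i j : ℤ),
      (((⟨x, (i : S.indexSystem.G x)⟩, ⟨y, (j : S.indexSystem.G y)⟩) :
        S.indexSystem.Base × S.indexSystem.Base) ∈ R) ↔
      ((⟨x, (i : S.indexSystem.G x)⟩, ⟨y, (j : S.indexSystem.G y)⟩) :
        S.indexSystem.Base × S.indexSystem.Base) ∈ T) : R = T := by
  ext ⟨⟨x, a⟩, ⟨y, b⟩⟩
  obtain ⟨i, rfl⟩ := ZMod.intCast_surjective a
  obtain ⟨j, rfl⟩ := ZMod.intCast_surjective b
  exact h x y i j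

/-- Labels are atoms, and an atom below a supremum is below one of its members. -/
theorem represent_eq_iUnion (hα : IsScaffold α) {X : Set A} {a : A} (h : IsLUB X a) :
    represent S α a = ⋃ r ∈ X, represent S α r := by
  refine ext_points fun x y i j => ?_
  simp only [Set.mem_iUnion, mem_represent hα, exists_prop]
  constructor
  · rintro ⟨hl, hle⟩
    by_contra! hcon
    have hat := isAtom_label (S := S) hα hl (j - i)
    have h1 : a ≤ (label α S x y (j - i))ᶜ := h.2 fun r hr => by
      rw [le_compl_iff_disjoint_left]
      by_contra hd
      exact hcon r hr hl (hat.le_of_not_disjoint hd)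
    exact hat.not_disjoint_of_le hle (le_compl_iff_disjoint_left.mp h1)
  · rintro ⟨r, hr, hl, hle⟩
    exact ⟨hl, hle.trans (h.1 hr)⟩

/-- The representation as a map into the cyclic group relation algebra. -/
def representation (hα : IsScaffold α) (r : A) : S.indexSystem.algebra.Elem :=
  ⟨represent S α r, represent_mem hα r⟩

/-- The representation is an embedding. -/
theorem isEmbedding_represent (hA : IsMeasurable A) (hu : ∀ x y, S.u x y = 1)
    (hα : IsScaffold α) :
    IsEmbedding (representation (S := S) hα) where
  injective := by
    have key : ∀ r s : A, represent S α r = represent S α s → r ≤ s := by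
      intro r s h
      by_contra hrs
      have h0 : r ⊓ sᶜ ≠ ⊥ := fun h' => hrs (disjoint_compl_right_iff.mp (disjoint_iff.mpr h'))
      obtain ⟨x, y, a, ha, hta, hle⟩ := exists_typed_atom_le hA S h0
      obtain ⟨k, rfl⟩ := exists_eq_label (S := S) hα ha hta
      have h1 := (mem_represent (S := S) hα r x y 0 k).mpr
        ⟨⟨_, ha, hta⟩, by rw [sub_zero]; exact hle.trans inf_le_left⟩
      rw [h, mem_represent hα, sub_zero] at h1
      exact ha.not_disjoint_of_le h1.2 (le_compl_iff_disjoint_right.mp (hle.trans inf_le_right))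
    intro r s h
    have h' := congrArg (fun T : S.indexSystem.algebra.Elem => T.1) h
    exact le_antisymm (key r s h') (key s r h'.symm)
  map_sup r s := Subtype.ext (by
    change represent S α (r ⊔ s) = represent S α r ∪ represent S α s
    rw [represent_eq_iUnion (S := S) hα (isLUB_pair (a := r) (b := s)), Set.biUnion_pair])
  map_compl r := Subtype.ext (by
    change represent S α rᶜ = {p | S.indexSystem.E p.1.1 p.2.1} \ represent S α r
    refine ext_points fun x y i j => ?_
    rw [Set.mem_sdiff, mem_represent hα, mem_represent hα]
    change _ ↔ Linked x y ∧ _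
    refine and_congr_right fun hl => ?_
    have hat := isAtom_label (S := S) hα hl (j - i)
    rw [le_compl_iff_disjoint_right]
    exact ⟨fun h h' => hat.not_disjoint_of_le h'.2 h,
      fun h => by
        by_contra hd
        exact h ⟨hl, hat.le_of_not_disjoint hd⟩⟩)
  map_comp r s := Subtype.ext (by
    change represent S α (comp r s) = (represent S α r).comp (represent S α s)
    refine ext_points fun x z i k => ?_
    rw [mem_represent hα]
    constructor
    · rintro ⟨hl, hle⟩
      obtain ⟨y, hxy, hyz, l, h1, h2⟩ := exists_label_le_of_le_comp hA hu hα hl hle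
      refine ⟨⟨y, ((i + l : ℤ) : S.indexSystem.G y)⟩, (mem_represent hα _ _ _ _ _).mpr ⟨hxy, ?_⟩,
        (mem_represent hα _ _ _ _ _).mpr ⟨hyz, ?_⟩⟩
      · rwa [add_sub_cancel_left]
      · rwa [← sub_sub]
    · rintro ⟨⟨y, b⟩, h1, h2⟩
      obtain ⟨j, rfl⟩ := ZMod.intCast_surjective b
      rw [mem_represent hα] at h1 h2
      refine ⟨h1.1.trans S h2.1, ?_⟩
      have h3 := label_add_le_comp (S := S) hu hα h1.1 h2.1 (j - i) (k - j)
      rw [show j - i + (k - j) = k - i by ring] at h3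
      exact h3.trans (comp_mono h1.2 h2.2))
  map_conv r := Subtype.ext (by
    change represent S α (conv r) = (represent S α r).inv
    refine ext_points fun x y i j => ?_
    change _ ↔ ((⟨y, (j : S.indexSystem.G y)⟩, ⟨x, (i : S.indexSystem.G x)⟩) :
        S.indexSystem.Base × S.indexSystem.Base) ∈ represent S α r
    rw [mem_represent hα, mem_represent hα]
    have hs : Linked x y ↔ Linked y x := ⟨Linked.symm, Linked.symm⟩
    rw [hs]
    refine and_congr_right fun hl => ?_
    rw [← neg_sub i j, ← conv_label hu hα hl, conv_le_conv])
  map_ident := Subtype.ext (by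
    change represent S α ident = SetRel.id
    refine ext_points fun x y i j => ?_
    rw [mem_represent hα]
    change _ ↔ (⟨x, (i : S.indexSystem.G x)⟩ : S.indexSystem.Base) =
      ⟨y, (j : S.indexSystem.G y)⟩
    constructor
    · rintro ⟨hl, hle⟩
      rw [label_le_ident_iff hα hl] at hle
      obtain ⟨rfl, hd⟩ := hle
      have h1 : (i : ZMod (S.m x x)) = j := (ZMod.intCast_eq_intCast_iff_dvd_sub _ _ _).mpr hd
      exact congrArg (Sigma.mk x) h1
    · intro h
      obtain rfl : x = y := congrArg Sigma.fst h
      have h1 : (i : ZMod (S.m x x)) = j := eq_of_heq (Sigma.mk.inj h).2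
      refine ⟨Linked.refl x, (label_le_ident_iff hα (Linked.refl x) _).mpr ⟨rfl, ?_⟩⟩
      exact (ZMod.intCast_eq_intCast_iff_dvd_sub _ _ _).mp h1)

/-- The representation exhibits the cyclic group relation algebra as the completion. -/
theorem isCompletion_represent (hA : IsMeasurable A) (hu : ∀ x y, S.u x y = 1)
    (hα : IsScaffold α) :
    IsCompletion (representation (S := S) hα) where
  toIsEmbedding := isEmbedding_represent hA hu hα
  complete X := by
    refine ⟨⟨⋃ T ∈ X, T.1, (S.indexSystem.mem_carrier_iff _).mpr fun x y i j h => ?_⟩, ?_, ?_⟩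
    · simp only [Set.mem_iUnion] at h
      obtain ⟨T, hT, h⟩ := h
      obtain ⟨hE, h'⟩ := (S.indexSystem.mem_carrier_iff T.1).mp T.2 x y i j h
      refine ⟨hE, fun i' j' hd => ?_⟩
      simp only [Set.mem_iUnion]
      exact ⟨T, hT, h' i' j' hd⟩
    · exact fun T hT => Set.subset_biUnion_of_mem
        (u := fun T : S.indexSystem.algebra.Elem => T.1) hT
    · exact fun T hT => Set.iUnion₂_subset fun V hV => hT hV
  dense T := by
    refine ⟨fun c hc => hc.2, fun V hV => ?_⟩
    rintro ⟨⟨x, a⟩, ⟨y, b⟩⟩ hp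
    obtain ⟨i, rfl⟩ := ZMod.intCast_surjective a
    obtain ⟨j, rfl⟩ := ZMod.intCast_surjective b
    obtain ⟨hl, h⟩ := (S.indexSystem.mem_carrier_iff T.1).mp T.2 x y i j hp
    have hat := isAtom_label (S := S) hα hl (j - i)
    -- The image of the label of a pair in `T` stays inside `T`: pairs with equal labels have the
    -- same `x` and `y`, and their differences agree modulo `m x y`.
    refine hV ⟨⟨label α S x y (j - i), rfl⟩, ?_⟩ ((mem_represent hα _ _ _ _ _).mpr ⟨hl, le_rfl⟩)
    rintro ⟨⟨x', a⟩, ⟨y', b⟩⟩ hq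
    obtain ⟨i', rfl⟩ := ZMod.intCast_surjective a
    obtain ⟨j', rfl⟩ := ZMod.intCast_surjective b
    obtain ⟨hl', hle⟩ := (mem_represent hα _ _ _ _ _).mp hq
    have heq := (isAtom_label (S := S) hα hl' (j' - i')).eq_of_le hat hle
    have ht := typed_label (S := S) hα hl (j - i)
    have ht' := typed_label (S := S) hα hl' (j' - i')
    rw [heq] at ht'
    obtain rfl : x' = x := Subtype.ext (typed_left_unique x'.2.isAtom x.2.isAtom
      x'.2.le_ident x.2.le_ident ht' ht hat.1)
    obtain rfl : y' = y := Subtype.ext (typed_left_unique y'.2.isAtom y.2.isAtom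
      y'.2.le_ident y.2.le_ident (ht'.conv x'.2.le_ident y'.2.le_ident)
      (ht.conv x'.2.le_ident y.2.le_ident) (conv_ne_bot hat.1))
    exact h i' j' ((label_eq_iff (S := S) hα hl _ _).mp heq)

end GeneratorSystem

/-- An embedding into a set relation algebra that takes suprema to unions gives rise to a complete
representation. -/
theorem completelyRepresentable_of_isEmbedding {U : Type u} {D : SetRelationAlgebra U}
    {e : A → D.Elem} (he : IsEmbedding e)
    (hsup : ∀ (X : Set A) (a : A), IsLUB X a → (e a).1 = ⋃ x ∈ X, (e x).1) :
    CompletelyRepresentable A := by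
  have htop : (e ⊤).1 = D.unit := by
    have h1 : e ⊤ = ⊤ := by
      rw [← sup_compl_eq_top (x := (⊤ : A)), he.map_sup, he.map_compl, sup_compl_eq_top]
    rw [h1]
    rfl
  -- The image of `e`, with the same unit because `e` preserves `⊤`; the map onto it is surjective
  -- by construction.
  let S : SetRelationAlgebra U :=
    { carrier := Set.range fun a => (e a).1
      unit := D.unit
      unit_mem := ⟨⊤, htop⟩
      subset_unit := by
        rintro _ ⟨a, rfl⟩
        exact D.subset_unit _ (e a).2
      union_mem := by
        rintro _ ⟨a, rfl⟩ _ ⟨b, rfl⟩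
        exact ⟨a ⊔ b, congrArg Subtype.val (he.map_sup a b)⟩
      compl_mem := by
        rintro _ ⟨a, rfl⟩
        exact ⟨aᶜ, congrArg Subtype.val (he.map_compl a)⟩
      comp_mem := by
        rintro _ ⟨a, rfl⟩ _ ⟨b, rfl⟩
        exact ⟨comp a b, congrArg Subtype.val (he.map_comp a b)⟩
      inv_mem := by
        rintro _ ⟨a, rfl⟩
        exact ⟨conv a, congrArg Subtype.val (he.map_conv a)⟩
      id_mem := ⟨ident, congrArg Subtype.val he.map_ident⟩ }
  refine ⟨U, S, fun a => ⟨(e a).1, a, rfl⟩, ?_, hsup⟩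
  exact
    { injective := fun a b h => he.injective (Subtype.ext (congrArg (fun T : S.Elem => T.1) h :))
      map_sup := fun a b => Subtype.ext (congrArg Subtype.val (he.map_sup a b) :)
      map_compl := fun a => Subtype.ext (congrArg Subtype.val (he.map_compl a) :)
      map_comp := fun a b => Subtype.ext (congrArg Subtype.val (he.map_comp a b) :)
      map_conv := fun a => Subtype.ext (congrArg Subtype.val (he.map_conv a) :)
      map_ident := Subtype.ext (congrArg Subtype.val he.map_ident :)
      surjective := by
        rintro ⟨_, a, rfl⟩
        exact ⟨a, rfl⟩ }

theorem isIsomorphism_id : IsIsomorphism (id : A → A) where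
  injective := Function.injective_id
  map_sup _ _ := rfl
  map_compl _ := rfl
  map_comp _ _ := rfl
  map_conv _ := rfl
  map_ident := rfl
  surjective := Function.surjective_id

end Representation

end RelationAlgebra
end RelAlg

theorem mainTheorem1 {A : Type u} [RelAlg.RelationAlgebra A]
    (hA : RelAlg.RelationAlgebra.IsMeasurable A)
    (hG : ∀ x : {x : A // RelAlg.RelationAlgebra.IsMeasurableAtom x},
      Finite (RelAlg.RelationAlgebra.AtomGroup x) ∧
        IsCyclic (RelAlg.RelationAlgebra.AtomGroup x)) :
    (∃ (I : Type u) (D : RelAlg.IndexSystem I),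
      RelAlg.RelationAlgebra.EssentiallyIsomorphic A D.algebra.Elem) ∧
    RelAlg.CompletelyRepresentable A := by
  obtain ⟨S₀⟩ := RelAlg.RelationAlgebra.nonempty_generatorSystem A hG
  obtain ⟨S, hu⟩ := S₀.exists_coherent
  obtain ⟨α, hα⟩ := S.exists_scaffold hu
  have hc := RelAlg.RelationAlgebra.GeneratorSystem.isCompletion_represent hA hu hα
  exact ⟨⟨_, S.indexSystem, S.indexSystem.algebra.Elem, inferInstance, ⟨_, hc⟩, id,
    RelAlg.RelationAlgebra.isIsomorphism_id⟩,
    RelAlg.RelationAlgebra.completelyRepresentable_of_isEmbedding hc.toIsEmbedding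
      fun _ _ h => RelAlg.RelationAlgebra.GeneratorSystem.represent_eq_iUnion hα h⟩
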